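/- Let $m\ge 1$ and $n$ be integers and let $p>m$ be a real number. Denote by $G(n,m)$ the set of $m$-dimensional linear subspaces of $\mathbb{R}^n$, by $\mathcal{H}^d$ the $d$-dimensional Hausdorff measure on $\mathbb{R}^n$, and by $\mathbb{B}(x,R)$ open balls. A set $\Sigma\subset\mathbb{R}^n$ is called an $m$-dimensional $W^{2,p}$-manifold if for every $x\in\Sigma$ there are a plane $P\in G(n,m)$, a radius $R>0$ and a function $f\in W^{2,p}\big(P\cap\mathbb{B}(0,2R),P^{\perp}\big)$ (identified with its continuous representative) such that $$\Sigma\cap\mathbb{B}(x,R)=x+\big(\operatorname{graph} f\cap\mathbb{B}(0,R)\big),\qquad \operatorname{graph} f=\{z+f(z): z\in P\cap\mathbb{B}(0,2R)\}.$$ For $x\in\Sigma$ define the global Menger curvature $$\mathcal{K}_G[\Sigma](x)=\sup_{x_1,\dots,x_{m+1}\in\Sigma}\frac{\mathcal{H}^{m+1}(\operatorname{conv}\{x,x_1,\dots,x_{m+1}\})}{(\operatorname{diam}\{x,x_1,\dots,x_{m+1}\})^{m+2}}\in[0,\infty]$$ (the quotient is read as $0$ if all the points coincide) and, for a map $H:\Sigma\to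 G(n,m)$, the global tangent-point curvature $$\mathcal{K}_{\mathrm{tp}}[\Sigma](x)=\sup_{y\in\Sigma}\frac{1}{R_{\mathrm{tp}}(x,y;H(x))}\in[0,\infty],\qquad R_{\mathrm{tp}}(x,y;H)=\frac{|y-x|^2}{2\operatorname{dist}(y,x+H)},$$ with $1/R_{\mathrm{tp}}(x,y;H)=0$ if $y\in x+H$. Theorem. Let $\Sigma\subset\mathbb{R}^n$ be a compact $m$-dimensional $W^{2,p}$-manifold. Then: 1. $\mathcal{K}_G[\Sigma]\in L^p(\Sigma,\mathcal{H}^m)$; 2. at each $x\in\Sigma$ the set $\Sigma$ has an $m$-dimensional tangent plane $T_x\Sigma\in G(n,m)$, namely the set of all limits of $c_k(x_k-x)$ with $x_k\in\Sigma$, $x_k\to x$ and $c_k\in\mathbb{R}$; and for the choice $H(x)=T_x\Sigma$ one has $\mathcal{K}_{\mathrm{tp}}[\Sigma]\in L^p(\Sigma,\mathcal{H}^m)$. -/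

import Mathlib

open MeasureTheory Set Metric
open scoped ENNReal ContDiff

noncomputable section

/-- The `d`-dimensional Hausdorff measure with the usual normalisation: Mathlib's `μH[d]` is the
version without the factor `ω_d / 2 ^ d`, and `ω_d / 2 ^ d` is the volume of a ball of radius `1/2`
in `ℝ^d`. -/
def hausdorff {n : ℕ} (d : ℕ) : Measure (EuclideanSpace ℝ (Fin n)) :=
  volume (ball (0 : EuclideanSpace ℝ (Fin d)) (1 / 2)) • Measure.hausdorffMeasure (d : ℝ)

section Sobolev

variable {V : Type*} [NormedAddCommGroup V] [InnerProductSpace ℝ V] [FiniteDimensional ℝ V]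
  [MeasurableSpace V] [BorelSpace V]
  {W : Type*} [NormedAddCommGroup W] [NormedSpace ℝ W]

/-- `g` is the weak (distributional) derivative of `f` in the open set `U`. -/
def HasWeakDeriv (U : Set V) (f : V → W) (g : V → V →L[ℝ] W) : Prop :=
  LocallyIntegrableOn f U ∧ LocallyIntegrableOn g U ∧
    ∀ φ : V → ℝ, ContDiff ℝ ∞ φ → HasCompactSupport φ → tsupport φ ⊆ U → ∀ v : V,
      ∫ x in U, (fderiv ℝ φ x v) • f x = -∫ x in U, φ x • g x v

/-- `f` belongs to the Sobolev space `W^{2,p}(U, W)`. -/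
def MemW2 (p : ℝ) (U : Set V) (f : V → W) : Prop :=
  ∃ (g : V → V →L[ℝ] W) (h : V → V →L[ℝ] V →L[ℝ] W),
    HasWeakDeriv U f g ∧ HasWeakDeriv U g h ∧
    MemLp f (ENNReal.ofReal p) (volume.restrict U) ∧
    MemLp g (ENNReal.ofReal p) (volume.restrict U) ∧
    MemLp h (ENNReal.ofReal p) (volume.restrict U)

end Sobolev

variable {n : ℕ}

/-- The graph, as a subset of `ℝ^n = P ⊕ Pᗮ`, of a function `f` with domain `U ⊆ P` and values
in `Pᗮ`. -/
def graphOver (P : Submodule ℝ (EuclideanSpace ℝ (Fin n))) (U : Set P) (f : P → Pᗮ) :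
    Set (EuclideanSpace ℝ (Fin n)) :=
  (fun z : P => (z : EuclideanSpace ℝ (Fin n)) + (f z : EuclideanSpace ℝ (Fin n))) '' U

/-- `S` is an `m`-dimensional `W^{2,p}`-manifold without boundary: near each of its points, `S` is
the graph over a ball of some `m`-plane `P` of a (continuous representative of a) `W^{2,p}`
function. -/
def IsW2Manifold (m : ℕ) (p : ℝ) (S : Set (EuclideanSpace ℝ (Fin n))) : Prop :=
  ∀ x ∈ S, ∃ P : Submodule ℝ (EuclideanSpace ℝ (Fin n)), Module.finrank ℝ P = m ∧
    ∃ R : ℝ, 0 < R ∧ ∃ f : P → Pᗮ,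
      MemW2 p (ball 0 (2 * R)) f ∧ ContinuousOn f (ball 0 (2 * R)) ∧
      S ∩ ball x R = (fun y => x + y) '' (graphOver P (ball 0 (2 * R)) f ∩ ball 0 R)

/-- The tangent space of `S` at `x`: the linear subspace generated by the tangent cone, i.e. by the
limits of `c_k (x_k - x)` with `x_k ∈ S`, `x_k → x` and `c_k ∈ ℝ`. -/
def tangentPlane (S : Set (EuclideanSpace ℝ (Fin n))) (x : EuclideanSpace ℝ (Fin n)) :
    Submodule ℝ (EuclideanSpace ℝ (Fin n)) :=
  Submodule.span ℝ (tangentConeAt ℝ S x)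

/-- `K(x_0, …, x_{m+1})`, the `(m+1)`-volume of the simplex divided by the `(m+2)`-nd power of its
diameter; it is `0` if all the points coincide (`0 / 0 = 0` in `ℝ≥0∞`). -/
def mengerK (m : ℕ) (x : Fin (m + 2) → EuclideanSpace ℝ (Fin n)) : ℝ≥0∞ :=
  hausdorff (m + 1) (convexHull ℝ (range x)) / ediam (range x) ^ (m + 2)

/-- The global Menger curvature of `S` at `x`. -/
def globalMenger (m : ℕ) (S : Set (EuclideanSpace ℝ (Fin n))) (x : EuclideanSpace ℝ (Fin n)) :
    ℝ≥0∞ :=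
  ⨆ (y : Fin (m + 1) → EuclideanSpace ℝ (Fin n)) (_ : ∀ i, y i ∈ S), mengerK m (Fin.cons x y)

open Classical in
/-- The tangent-point radius `R_tp(x, y; H) = |y - x|² / (2 dist(y, x + H))`, which is `∞` if
`y ∈ x + H`. -/
def tangentPointRadius (x y : EuclideanSpace ℝ (Fin n))
    (H : Submodule ℝ (EuclideanSpace ℝ (Fin n))) : ℝ≥0∞ :=
  if y ∈ AffineSubspace.mk' x H then ⊤
  else edist y x ^ 2 / (2 * infEDist y (AffineSubspace.mk' x H : Set (EuclideanSpace ℝ (Fin n))))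

/-- The global tangent-point curvature of `S` at `x` with respect to the field of planes `H`. -/
def globalTangentPoint (S : Set (EuclideanSpace ℝ (Fin n)))
    (H : EuclideanSpace ℝ (Fin n) → Submodule ℝ (EuclideanSpace ℝ (Fin n)))
    (x : EuclideanSpace ℝ (Fin n)) : ℝ≥0∞ :=
  ⨆ y ∈ S, (tangentPointRadius x y (H x))⁻¹

end

/-! Both curvatures at a point of a local graph of `f` are bounded by a constant plus a multiple of
one function `N` on the parameter plane, where `N z` controls the second-order Taylor remainder: |f
w - f z - Df(z)(w - z)| ≤ N z |w - z|². Everything rests on finding such an `N` in L^p.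

Choose q with m < q < p. Morrey's inequality for Df on a ball of radius r about z bounds the
oscillation of Df by C r times the q-mean of |D²f|, hence by C r M(|D²f|^q)(z)^(1/q), with M the
maximal function. The mean value inequality with r = |w - z| then gives the remainder with N = C
M(|D²f|^q)^(1/q). Since |D²f|^q lies in L^(p/q) and p/q > 1, the maximal theorem puts N in L^p. This
is `MemW2.exists_taylor`; the estimates are proved for mollifications and passed to the limit.

The remainder says that near y the set lies within N |· - y|² of the plane y + T_y. For the
tangent-point curvature this is the desired bound (`TaylorChart.globalTangentPoint_le`). For the
Menger curvature, a simplex of diameter d with vertex y lies in a slab of half-width N d² about an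
m-plane, so its volume is at most C N d² d^m (`hausdorffMeasure_convexHull_le`,
`TaylorChart.globalMenger_le`). Configurations reaching far from y contribute a bounded amount.

Local Lipschitz parametrisations carry the L^p bound to the set, and compactness makes it global.
Measurability holds because both curvatures are suprema of lower semicontinuous functions, the
tangent-point one inside each chart; the index sets may thus be uncountable. -/

/-! ### The Hardy–Littlewood maximal function of a measure. -/

section Maximal

open Module Filter Topology

variable {V : Type*} [NormedAddCommGroup V] [NormedSpace ℝ V] [FiniteDimensional ℝ V]
  [MeasurableSpace V] [BorelSpace V]

/-- The centred maximal function, over radii at most `ρ`, of a measure `ν` with respect to `μ`. -/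
noncomputable def maximalFn (μ ν : Measure V) (ρ : ℝ) (x : V) : ℝ≥0∞ :=
  ⨆ (r : ℝ) (_ : 0 < r ∧ r ≤ ρ), ν (ball x r) / μ (ball x r)

-- An open ball is exhausted by smaller concentric balls, and each of these stays inside the ball of
-- radius `r` about any sufficiently close centre.
omit [NormedSpace ℝ V] [FiniteDimensional ℝ V] [BorelSpace V] in
theorem lowerSemicontinuous_measure_ball (ν : Measure V) (r : ℝ) :
    LowerSemicontinuous fun x => ν (ball x r) := by
  intro x c hc
  have hU : ball x r = ⋃ k : ℕ, ball x (r - 1 / (k + 1)) := by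
    ext y
    simp only [mem_ball, mem_iUnion]
    constructor
    · intro h
      obtain ⟨k, hk⟩ := exists_nat_one_div_lt (sub_pos.2 h)
      exact ⟨k, by linarith⟩
    · rintro ⟨k, hk⟩
      have : (0 : ℝ) < 1 / (k + 1) := by positivity
      linarith
  have hmono : Monotone fun k : ℕ => ball x (r - 1 / ((k : ℝ) + 1)) := by
    intro a b hab
    apply ball_subset_ball
    have : (1 : ℝ) / (b + 1) ≤ 1 / (a + 1) := by
      apply one_div_le_one_div_of_le (by positivity)
      exact_mod_cast Nat.add_le_add_right hab 1
    linarith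
  simp only [hU, hmono.measure_iUnion] at hc
  obtain ⟨k, hk⟩ := lt_iSup_iff.1 hc
  have : (0 : ℝ) < 1 / (k + 1) := by positivity
  filter_upwards [ball_mem_nhds x this] with y hy
  refine hk.trans_le (measure_mono ?_)
  intro z hz
  rw [mem_ball] at *
  have := dist_triangle z x y
  rw [dist_comm x y] at this
  linarith

theorem measurable_maximalFn (μ ν : Measure V) [μ.IsAddHaarMeasure] (ρ : ℝ) :
    Measurable (maximalFn μ ν ρ) := by
  apply LowerSemicontinuous.measurable
  refine lowerSemicontinuous_biSup fun r hr => ?_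
  have h0 : μ (ball 0 r) ≠ 0 := (measure_ball_pos μ 0 hr.1).ne'
  have h1 : μ (ball 0 r) ≠ ⊤ := measure_ball_lt_top.ne
  intro x c hc
  have : ∀ y, μ (ball y r) = μ (ball 0 r) := fun y => Measure.addHaar_ball_center μ y r
  simp only [this, gt_iff_lt] at hc ⊢
  rw [ENNReal.lt_div_iff_mul_lt (Or.inl h0) (Or.inl h1)] at hc
  filter_upwards [lowerSemicontinuous_measure_ball ν r x _ hc] with y hy
  rwa [ENNReal.lt_div_iff_mul_lt (Or.inl h0) (Or.inl h1)]

/-- The weak type `(1, 1)` estimate. -/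
theorem mul_measure_lt_maximalFn_le (μ ν : Measure V) [μ.IsAddHaarMeasure] (ρ : ℝ) (t : ℝ≥0∞) :
    t * μ {x | t < maximalFn μ ν ρ x} ≤ 4 ^ finrank ℝ V * ν univ := by
  set A := {x | t < maximalFn μ ν ρ x} with hA
  have hx : ∀ x : A, ∃ r : ℝ, (0 < r ∧ r ≤ ρ) ∧ t * μ (ball (x : V) r) ≤ ν (ball (x : V) r) := by
    rintro ⟨x, hx⟩
    simp only [hA, mem_ofPred_eq, maximalFn, lt_iSup_iff] at hx
    obtain ⟨r, hr, h⟩ := hx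
    refine ⟨r, hr, ?_⟩
    rw [ENNReal.lt_div_iff_mul_lt (Or.inl (measure_ball_pos μ x hr.1).ne')
      (Or.inl measure_ball_lt_top.ne)] at h
    exact h.le
  choose r hr hν using hx
  -- The cap `ρ` supplies the bounded radii that Vitali's covering lemma needs. Any enlargement
  -- factor above 3 would do; 4 produces the constant.
  obtain ⟨u, -, hd, hu⟩ := Vitali.exists_disjoint_subfamily_covering_enlargement_ball
    (univ : Set A) (fun x => (x : V)) r ρ (fun a _ => (hr a).2) 4 (by norm_num)
  have huc : u.Countable := hd.countable_of_isOpen (fun _ _ => isOpen_ball)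
    fun a _ => nonempty_ball.2 (hr a).1
  have hcov : A ⊆ ⋃ b ∈ u, ball (b : V) (4 * r b) := by
    intro x hx
    obtain ⟨b, hb, h⟩ := hu ⟨x, hx⟩ (mem_univ _)
    exact mem_biUnion hb (h (mem_ball_self (hr ⟨x, hx⟩).1))
  have hscale : ∀ b : A, μ (ball (b : V) (4 * r b)) = 4 ^ finrank ℝ V * μ (ball (b : V) (r b)) := by
    intro b
    rw [Measure.addHaar_ball_mul_of_pos μ _ (by norm_num), Measure.addHaar_ball_center μ (b : V),
      ENNReal.ofReal_pow (by norm_num)]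
    norm_num
  calc t * μ A ≤ t * ∑' b : u, μ (ball ((b : A) : V) (4 * r b)) := by
        gcongr
        exact (measure_mono hcov).trans (measure_biUnion_le μ huc _)
    _ = 4 ^ finrank ℝ V * ∑' b : u, t * μ (ball ((b : A) : V) (r b)) := by
        simp only [hscale, ENNReal.tsum_mul_left]
        ring
    _ ≤ 4 ^ finrank ℝ V * ∑' b : u, ν (ball ((b : A) : V) (r b)) := by
        gcongr with b
        exact hν b
    _ = 4 ^ finrank ℝ V * ν (⋃ b ∈ u, ball (b : V) (r b)) := by
        rw [measure_biUnion huc hd fun _ _ => measurableSet_ball]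
    _ ≤ _ := by gcongr; exact subset_univ _

/-- The `L^s` bound, `1 < s`, for the maximal function of an integrable density in `L^s`. -/
theorem lintegral_maximalFn_rpow_lt_top (μ : Measure V) [μ.IsAddHaarMeasure] (ρ : ℝ) {s : ℝ}
    (hs : 1 < s) {φ : V → ℝ} (hφm : Measurable φ) (hφ : ∀ x, 0 ≤ φ x)
    (h1 : ∫⁻ x, ENNReal.ofReal (φ x) ∂μ < ⊤) (h2 : ∫⁻ x, ENNReal.ofReal (φ x) ^ s ∂μ < ⊤) :
    ∫⁻ x, maximalFn μ (μ.withDensity fun x => ENNReal.ofReal (φ x)) ρ x ^ s ∂μ < ⊤ := by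
  set ν := μ.withDensity fun x => ENNReal.ofReal (φ x) with hν
  set M := maximalFn μ ν ρ with hM
  set C : ℝ≥0∞ := 4 ^ finrank ℝ V with hC
  have hMm : Measurable M := measurable_maximalFn μ ν ρ
  have hνu : ν univ < ⊤ := by rwa [hν, withDensity_apply _ .univ, setLIntegral_univ]
  have hCt : C < ⊤ := by simp [hC]
  -- The splitting of the density at height `t / 2`.
  have hweak : ∀ t : ℝ, 0 < t →
      ENNReal.ofReal t * μ {x | ENNReal.ofReal t < M x} ≤ 2 * C * ν {x | t < 2 * φ x} := by
    intro t ht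
    have hB : MeasurableSet {x | t < 2 * φ x} := measurableSet_lt measurable_const (by fun_prop)
    -- Where the density is at most t/2 it adds at most t/2 to every average. So M > t forces the
    -- maximal function of the remaining part `ν'` above t/2, and the weak type bound is applied to
    -- `ν'`.
    set ν' := ν.restrict {x | t < 2 * φ x} with hν'
    have hle : ∀ x, M x ≤ maximalFn μ ν' ρ x + ENNReal.ofReal (t / 2) := by
      intro x
      refine iSup₂_le fun r hr => ?_
      have h0 : μ (ball x r) ≠ 0 := (measure_ball_pos μ x hr.1).ne'
      have h1 : μ (ball x r) ≠ ⊤ := measure_ball_lt_top.ne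
      have : ν (ball x r) ≤ ν' (ball x r) + ENNReal.ofReal (t / 2) * μ (ball x r) := by
        rw [← measure_inter_add_sdiff (ball x r) hB, hν', Measure.restrict_apply measurableSet_ball]
        gcongr
        rw [hν, withDensity_apply _ (measurableSet_ball.diff hB)]
        calc _ ≤ ∫⁻ y in ball x r \ {x | t < 2 * φ x}, ENNReal.ofReal (t / 2) ∂μ := by
              refine setLIntegral_mono measurable_const fun y hy => ?_
              apply ENNReal.ofReal_le_ofReal
              have := hy.2
              simp only [mem_ofPred_eq, not_lt] at this
              linarith
          _ ≤ _ := by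
              rw [setLIntegral_const]
              gcongr
              exact sdiff_subset
      calc ν (ball x r) / μ (ball x r)
          ≤ (ν' (ball x r) + ENNReal.ofReal (t / 2) * μ (ball x r)) / μ (ball x r) := by gcongr
        _ = ν' (ball x r) / μ (ball x r) + ENNReal.ofReal (t / 2) := by
            rw [ENNReal.add_div, ENNReal.mul_div_cancel_right h0 h1]
        _ ≤ _ := by
            gcongr
            exact le_iSup₂_of_le r hr le_rfl
    have hsub : {x | ENNReal.ofReal t < M x} ⊆
        {x | ENNReal.ofReal (t / 2) < maximalFn μ ν' ρ x} := by
      intro x hx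
      simp only [mem_ofPred_eq] at hx ⊢
      by_contra! hcon
      have := (hle x).trans (add_le_add_left hcon _)
      rw [← ENNReal.ofReal_add (by positivity) (by positivity), add_halves] at this
      exact absurd hx this.not_gt
    have := mul_measure_lt_maximalFn_le μ ν' ρ (ENNReal.ofReal (t / 2))
    calc ENNReal.ofReal t * μ {x | ENNReal.ofReal t < M x}
        ≤ 2 * (ENNReal.ofReal (t / 2) * μ {x | ENNReal.ofReal (t / 2) < maximalFn μ ν' ρ x}) := by
          rw [← mul_assoc, ← ENNReal.ofReal_ofNat 2, ← ENNReal.ofReal_mul (by norm_num),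
            mul_div_cancel₀ t (by norm_num)]
          gcongr
      _ ≤ 2 * (C * ν' univ) := by gcongr
      _ = _ := by rw [hν', Measure.restrict_apply_univ, mul_assoc]
  -- The layer-cake formula is applied to `toReal` of `M`, so infinite values must be negligible;
  -- the weak bound at every height k ensures it.
  have hfin : ∀ᵐ x ∂μ, M x < ⊤ := by
    have : μ {x | M x = ⊤} = 0 := by
      by_contra hne
      have hk : ∀ k : ℕ, (k : ℝ≥0∞) * μ {x | M x = ⊤} ≤ C * ν univ := by
        intro k
        refine le_trans ?_ (mul_measure_lt_maximalFn_le μ ν ρ k)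
        refine mul_le_mul_right (measure_mono fun x hx => ?_) _
        simp only [mem_ofPred_eq] at hx ⊢
        rw [← hM, hx]
        exact ENNReal.natCast_lt_top k
      have htop : C * ν univ / μ {x | M x = ⊤} ≠ ⊤ :=
        ENNReal.div_ne_top (ENNReal.mul_lt_top hCt hνu).ne hne
      obtain ⟨k, hk'⟩ := ENNReal.exists_nat_gt htop
      have hlt : μ {x | M x = ⊤} ≠ ⊤ := by
        intro h
        have := hk 1
        rw [h] at this
        simp only [Nat.cast_one, one_mul, top_le_iff] at this
        exact (ENNReal.mul_lt_top hCt hνu).ne this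
      rw [ENNReal.div_lt_iff (Or.inl hne) (Or.inl hlt)] at hk'
      exact absurd hk' (hk k).not_gt
    rw [ae_iff]
    simpa using this
  have hMeq : ∀ᵐ x ∂μ, M x ^ s = ENNReal.ofReal ((M x).toReal ^ s) := by
    filter_upwards [hfin] with x hx
    rw [← ENNReal.ofReal_rpow_of_nonneg ENNReal.toReal_nonneg (by linarith),
      ENNReal.ofReal_toReal hx.ne]
  rw [lintegral_congr_ae hMeq, lintegral_rpow_eq_lintegral_meas_lt_mul μ
    (Eventually.of_forall fun _ => ENNReal.toReal_nonneg) hMm.ennreal_toReal.aemeasurable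
    (by linarith)]
  -- Layer cake with exponent s - 1 against ν = φ μ: the integral of (2φ)^(s-1) dν is a multiple of
  -- the integral of φ^s dμ. The exponent lost here is the factor t gained from the weak estimate.
  have hlay := lintegral_rpow_eq_lintegral_meas_lt_mul ν (f := fun x => 2 * φ x)
    (Eventually.of_forall fun x => mul_nonneg two_pos.le (hφ x))
    (by fun_prop) (sub_pos.2 hs)
  have hint : ∫⁻ x, ENNReal.ofReal ((2 * φ x) ^ (s - 1)) ∂ν < ⊤ := by
    rw [hν, lintegral_withDensity_eq_lintegral_mul _ (by fun_prop) (by fun_prop)]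
    have : ∀ x, ((fun x => ENNReal.ofReal (φ x)) * fun x => ENNReal.ofReal ((2 * φ x) ^ (s - 1))) x
        = ENNReal.ofReal (2 ^ (s - 1)) * ENNReal.ofReal (φ x) ^ s := by
      intro x
      simp only [Pi.mul_apply]
      rw [ENNReal.ofReal_rpow_of_nonneg (hφ x) (by linarith), ← ENNReal.ofReal_mul (hφ x),
        ← ENNReal.ofReal_mul (by positivity), Real.mul_rpow (by norm_num) (hφ x)]
      congr 1
      rcases (hφ x).eq_or_lt with h | h
      · rw [← h, Real.zero_rpow (by linarith), Real.zero_rpow (by linarith)]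
        simp
      · conv_rhs => rw [show s = 1 + (s - 1) by ring, Real.rpow_add h, Real.rpow_one]
        rw [show 1 + (s - 1) - 1 = s - 1 by ring]
        ring
    simp only [this]
    rw [lintegral_const_mul _ (by fun_prop)]
    exact ENNReal.mul_lt_top ENNReal.ofReal_lt_top h2
  rw [hlay] at hint
  have hint' : ∫⁻ t in Ioi (0 : ℝ), ν {a | t < 2 * φ a} * ENNReal.ofReal (t ^ (s - 1 - 1)) < ⊤ := by
    rcases ENNReal.mul_lt_top_iff.1 hint with h | h | h
    · exact h.2
    · simp only [ENNReal.ofReal_eq_zero] at h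
      linarith
    · rw [h]; exact ENNReal.zero_lt_top
  refine ENNReal.mul_lt_top ENNReal.ofReal_lt_top ?_
  calc ∫⁻ t in Ioi (0 : ℝ), μ {a | t < (M a).toReal} * ENNReal.ofReal (t ^ (s - 1))
      ≤ ∫⁻ t in Ioi (0 : ℝ), 2 * C * (ν {a | t < 2 * φ a} * ENNReal.ofReal (t ^ (s - 1 - 1))) := by
        refine setLIntegral_mono' measurableSet_Ioi fun t ht => ?_
        have ht : (0 : ℝ) < t := ht
        have hsub : {a | t < (M a).toReal} ⊆ {x | ENNReal.ofReal t < M x} := by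
          intro x hx
          exact (ENNReal.ofReal_lt_iff_lt_toReal ht.le
            (fun h => by simp [h] at hx; linarith)).2 hx
        have e : t ^ (s - 1) = t * t ^ (s - 1 - 1) := by
          conv_lhs => rw [show s - 1 = 1 + (s - 1 - 1) by ring, Real.rpow_add ht, Real.rpow_one]
        rw [e, ENNReal.ofReal_mul ht.le]
        calc _ ≤ (ENNReal.ofReal t * μ {x | ENNReal.ofReal t < M x}) *
              ENNReal.ofReal (t ^ (s - 1 - 1)) := by
              rw [← mul_assoc, mul_comm (μ _)]
              gcongr
          _ ≤ 2 * C * ν {x | t < 2 * φ x} * ENNReal.ofReal (t ^ (s - 1 - 1)) := by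
              exact mul_le_mul_left (hweak t ht) _
          _ = _ := by ring
    _ = 2 * C * ∫⁻ t in Ioi (0 : ℝ), ν {a | t < 2 * φ a} * ENNReal.ofReal (t ^ (s - 1 - 1)) :=
        lintegral_const_mul' _ _ (ENNReal.mul_lt_top (by simp) hCt).ne
    _ < ⊤ := ENNReal.mul_lt_top (ENNReal.mul_lt_top (by simp) hCt) hint'

end Maximal

/-! ### Morrey's inequality for C¹ functions on balls. -/

section Morrey

open Module Filter Topology

theorem lintegral_le_rpow_lintegral_rpow {α : Type*} [MeasurableSpace α] {μ : Measure α}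
    {f : α → ℝ≥0∞} (hf : AEMeasurable f μ) {q : ℝ} (hq : 1 ≤ q) :
    ∫⁻ x, f x ∂μ ≤ (∫⁻ x, f x ^ q ∂μ) ^ (1 / q) * μ univ ^ (1 - 1 / q) := by
  have := eLpNorm'_le_eLpNorm'_mul_rpow_measure_univ one_pos hq hf.aestronglyMeasurable
  simpa [eLpNorm'] using this

variable {V : Type*} [NormedAddCommGroup V] [NormedSpace ℝ V] [FiniteDimensional ℝ V]
  [MeasurableSpace V] [BorelSpace V] (μ : Measure V) [μ.IsAddHaarMeasure]
  {E : Type*} [NormedAddCommGroup E] [NormedSpace ℝ E]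

theorem lintegral_comp_homothety {F : V → ℝ≥0∞} (hF : Measurable F) (x : V) {t : ℝ} (ht : 0 < t) :
    ∫⁻ z, F (x + t • (z - x)) ∂μ = ENNReal.ofReal ((t ^ finrank ℝ V)⁻¹) * ∫⁻ z, F z ∂μ := by
  rw [lintegral_sub_right_eq_self (fun z => F (x + t • z)) x]
  have h := lintegral_map (μ := μ) (f := fun w => F (x + w)) (g := fun z : V => t • z)
    (by fun_prop) (by fun_prop)
  rw [← h, Measure.map_addHaar_smul μ ht.ne', lintegral_smul_measure,
    lintegral_add_left_eq_self F x, abs_of_pos (by positivity), smul_eq_mul]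

/-- The constant in Morrey's inequality. -/
noncomputable def morreyConst (V : Type*) [NormedAddCommGroup V] [NormedSpace ℝ V] (q : ℝ) :
    ℝ≥0∞ :=
  4 * ∫⁻ t in Ioo (0 : ℝ) 1, ENNReal.ofReal (t ^ (-(finrank ℝ V : ℝ) / q))

omit [FiniteDimensional ℝ V] [MeasurableSpace V] [BorelSpace V] in
theorem morreyConst_lt_top {q : ℝ} (hq0 : 0 < q) (hq : finrank ℝ V < q) :
    morreyConst V q < ⊤ := by
  refine ENNReal.mul_lt_top (by simp) ?_
  have h : IntervalIntegrable (fun t : ℝ => t ^ (-(finrank ℝ V : ℝ) / q)) volume 0 1 := by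
    apply intervalIntegral.intervalIntegrable_rpow'
    rw [lt_div_iff₀ hq0]
    linarith
  rw [intervalIntegrable_iff_integrableOn_Ioo_of_le zero_le_one] at h
  refine lt_of_le_of_lt (lintegral_mono fun t => ?_) h.2
  exact Real.ofReal_le_enorm _

/-- Integrate |Du| along the segments from `x`, whose length is at most 2r, and exchange the
integrals. At time t, Hölder and the homothety of ratio t about `x`, which maps the ball into
itself, cost t^(-dim/q). -/
theorem setLIntegral_enorm_sub_le {u : V → E} (hu : ContDiff ℝ 1 u) {q : ℝ} (hq1 : 1 ≤ q)
    {c x : V} {r : ℝ} (hr : 0 < r) (hx : x ∈ closedBall c r) :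
    ∫⁻ z in ball c r, ‖u x - u z‖ₑ ∂μ ≤ 2 * ENNReal.ofReal r *
      ((∫⁻ t in Ioo (0 : ℝ) 1, ENNReal.ofReal (t ^ (-(finrank ℝ V : ℝ) / q))) *
      ((∫⁻ z in ball c r, ‖fderiv ℝ u z‖ₑ ^ q ∂μ) ^ (1 / q) * μ (ball c r) ^ (1 - 1 / q))) := by
  have hDu : Continuous (fderiv ℝ u) := hu.continuous_fderiv one_ne_zero
  set D := fun z => ‖fderiv ℝ u z‖ₑ with hD
  have hDc : Continuous D := hDu.enorm
  have hq0 : 0 < q := by linarith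
  set I := ∫⁻ z in ball c r, D z ^ q ∂μ with hI
  have hpt : ∀ z ∈ ball c r, ‖u x - u z‖ₑ ≤
      2 * ENNReal.ofReal r * ∫⁻ t in Ioo (0 : ℝ) 1, D (x + t • (z - x)) := by
    intro z hz
    have hγ : ∀ t : ℝ, HasDerivAt (fun t : ℝ => x + t • (z - x)) (z - x) t := fun t => by
      simpa using ((hasDerivAt_id t).smul_const (z - x)).const_add x
    have hd : ∀ t : ℝ, HasDerivAt (fun t : ℝ => u (x + t • (z - x)))
        (fderiv ℝ u (x + t • (z - x)) (z - x)) t := fun t =>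
      ((hu.differentiable one_ne_zero).differentiableAt.hasFDerivAt).comp_hasDerivAt t (hγ t)
    have h1 := enorm_sub_le_lintegral_deriv_of_contDiffOn_Icc
      (f := fun t : ℝ => u (x + t • (z - x))) (a := 0) (b := 1)
      (ContDiff.contDiffOn (by fun_prop)) zero_le_one
    simp only [one_smul, zero_smul, add_zero, add_sub_cancel] at h1
    rw [← neg_sub, enorm_neg]
    refine h1.trans ?_
    rw [← restrict_Ioo_eq_restrict_Icc, ← lintegral_const_mul' _ _ (by finiteness)]
    refine lintegral_mono fun t => ?_
    simp only
    rw [(hd t).deriv, mul_comm]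
    refine (ContinuousLinearMap.le_opENorm _ _).trans ?_
    gcongr
    rw [← edist_eq_enorm_sub, edist_dist, ← ENNReal.ofReal_ofNat 2,
      ← ENNReal.ofReal_mul (by norm_num)]
    apply ENNReal.ofReal_le_ofReal
    have := dist_triangle_right z x c
    rw [mem_closedBall] at hx
    rw [mem_ball] at hz
    linarith
  have hin : ∀ t ∈ Ioo (0 : ℝ) 1, ∫⁻ z in ball c r, D (x + t • (z - x)) ∂μ ≤
      ENNReal.ofReal (t ^ (-(finrank ℝ V : ℝ) / q)) *
        (I ^ (1 / q) * μ (ball c r) ^ (1 - 1 / q)) := by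
    intro t ht
    have h1 := lintegral_le_rpow_lintegral_rpow (μ := μ.restrict (ball c r))
      (f := fun z => D (x + t • (z - x))) (by fun_prop) hq1
    refine h1.trans ?_
    rw [Measure.restrict_apply_univ, ← mul_assoc]
    gcongr
    have h2 : ∫⁻ z in ball c r, D (x + t • (z - x)) ^ q ∂μ ≤
        ENNReal.ofReal ((t ^ finrank ℝ V)⁻¹) * I := by
      rw [hI, ← lintegral_indicator measurableSet_ball, ← lintegral_indicator measurableSet_ball,
        ← lintegral_comp_homothety μ _ x ht.1]
      · refine lintegral_mono fun z => ?_
        by_cases hz : z ∈ ball c r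
        -- As `x` may lie on the boundary sphere, this uses that an open segment from a point of a
        -- closed convex set to an interior point stays in the interior.
        · have : x + t • (z - x) ∈ ball c r := by
            have h := (convex_closedBall c r).openSegment_closure_interior_subset_interior
              (x := x) (y := z) (by rwa [isClosed_closedBall.closure_eq])
              (by rwa [interior_closedBall _ hr.ne'])
            rw [interior_closedBall _ hr.ne'] at h
            apply h
            rw [openSegment_eq_image']
            exact ⟨t, ht, rfl⟩
          rw [indicator_of_mem hz, indicator_of_mem this]
        · rw [indicator_of_notMem hz]
          exact zero_le
      · exact (hDc.measurable.pow_const q).indicator measurableSet_ball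
    calc _ ≤ (ENNReal.ofReal ((t ^ finrank ℝ V)⁻¹) * I) ^ (1 / q) := by gcongr
      _ = _ := by
        rw [ENNReal.mul_rpow_of_nonneg _ _ (by positivity),
          ENNReal.ofReal_rpow_of_nonneg (inv_nonneg.2 (pow_nonneg ht.1.le _)) (by positivity)]
        congr 2
        rw [← Real.rpow_natCast, ← Real.rpow_neg ht.1.le, ← Real.rpow_mul ht.1.le]
        congr 1
        ring
  calc _ ≤ ∫⁻ z in ball c r, (2 * ENNReal.ofReal r *
          ∫⁻ t in Ioo (0 : ℝ) 1, D (x + t • (z - x))) ∂μ :=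
        setLIntegral_mono' measurableSet_ball hpt
    _ = 2 * ENNReal.ofReal r *
          ∫⁻ t in Ioo (0 : ℝ) 1, (∫⁻ z in ball c r, D (x + t • (z - x)) ∂μ) := by
        rw [lintegral_const_mul' _ _ (by finiteness), lintegral_lintegral_swap]
        exact (by fun_prop : Continuous fun y : V × ℝ =>
          D (x + y.2 • (y.1 - x))).measurable.aemeasurable
    _ ≤ 2 * ENNReal.ofReal r * ∫⁻ t in Ioo (0 : ℝ) 1, ENNReal.ofReal (t ^ (-(finrank ℝ V : ℝ) / q)) *
        (I ^ (1 / q) * μ (ball c r) ^ (1 - 1 / q)) := by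
        gcongr 2 * ENNReal.ofReal r * ?_
        exact setLIntegral_mono' measurableSet_Ioo hin
    _ = _ := by
        rw [lintegral_mul_const _ (by fun_prop)]

/-- Morrey's inequality on a ball. -/
theorem enorm_sub_le_of_mem_closedBall {u : V → E} (hu : ContDiff ℝ 1 u) {q : ℝ} (hq1 : 1 ≤ q)
    {c x y : V} {r : ℝ} (hr : 0 < r) (hx : x ∈ closedBall c r) (hy : y ∈ closedBall c r) :
    ‖u x - u y‖ₑ ≤ morreyConst V q * ENNReal.ofReal r *
      ((∫⁻ z in ball c r, ‖fderiv ℝ u z‖ₑ ^ q ∂μ) / μ (ball c r)) ^ (1 / q) := by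
  have h0 : μ (ball c r) ≠ 0 := (measure_ball_pos μ c hr).ne'
  have h1 : μ (ball c r) ≠ ⊤ := measure_ball_lt_top.ne
  set K := ∫⁻ t in Ioo (0 : ℝ) 1, ENNReal.ofReal (t ^ (-(finrank ℝ V : ℝ) / q)) with hK
  set I := ∫⁻ z in ball c r, ‖fderiv ℝ u z‖ₑ ^ q ∂μ with hI
  have hX := setLIntegral_enorm_sub_le μ hu hq1 hr hx
  have hY := setLIntegral_enorm_sub_le μ hu hq1 hr hy
  -- The triangle inequality through `u z` is integrated over z. The two endpoints turn the factor 2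
  -- of each estimate into the 4 of `morreyConst`.
  have hsum : ‖u x - u y‖ₑ * μ (ball c r) ≤
      morreyConst V q * ENNReal.ofReal r * (I ^ (1 / q) * μ (ball c r) ^ (1 - 1 / q)) := by
    calc ‖u x - u y‖ₑ * μ (ball c r) = ∫⁻ z in ball c r, ‖u x - u y‖ₑ ∂μ := by
          rw [setLIntegral_const]
      _ ≤ ∫⁻ z in ball c r, (‖u x - u z‖ₑ + ‖u y - u z‖ₑ) ∂μ := by
          refine lintegral_mono fun z => ?_
          simp only [← edist_eq_enorm_sub]
          exact edist_triangle_right _ _ _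
      _ = (∫⁻ z in ball c r, ‖u x - u z‖ₑ ∂μ) + ∫⁻ z in ball c r, ‖u y - u z‖ₑ ∂μ :=
          lintegral_add_left (by
            have := hu.continuous
            exact (by fun_prop : Continuous fun z => ‖u x - u z‖ₑ).measurable) _
      _ ≤ _ := (add_le_add hX hY).trans (le_of_eq (by rw [morreyConst, ← hK]; ring))
  rw [← ENNReal.le_div_iff_mul_le (Or.inl h0) (Or.inl h1)] at hsum
  refine hsum.trans (le_of_eq ?_)
  rw [mul_div_assoc, mul_div_assoc, ENNReal.div_rpow_of_nonneg _ _ (by positivity)]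
  congr 1
  rw [ENNReal.rpow_sub _ _ h0 h1, ENNReal.rpow_one, div_eq_mul_inv, div_eq_mul_inv, div_eq_mul_inv,
    mul_assoc, mul_left_comm (μ _), ENNReal.mul_inv_cancel h0 h1, mul_one, div_eq_mul_inv]

end Morrey

/-! ### Mollification of functions with weak derivatives. -/

section Mollify

open Module Filter Topology Convolution ContinuousLinearMap

variable {V : Type*} [NormedAddCommGroup V] [InnerProductSpace ℝ V] [FiniteDimensional ℝ V]
  [MeasurableSpace V] [BorelSpace V] {W : Type*} [NormedAddCommGroup W] [NormedSpace ℝ W]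

/-- The mollification by the bump function `φ` of `f`, extended by zero outside `U`. -/
noncomputable def mollify (φ : ContDiffBump (0 : V)) (U : Set V) (f : V → W) : V → W :=
  φ.normed volume ⋆[lsmul ℝ ℝ, volume] U.indicator f

theorem contDiff_mollify (φ : ContDiffBump (0 : V)) {U : Set V} {f : V → W}
    (hf : Integrable (U.indicator f)) : ContDiff ℝ 1 (mollify φ U f) :=
  φ.hasCompactSupport_normed.contDiff_convolution_left _ (φ.contDiff_normed (n := 1))
    hf.locallyIntegrable

theorem HasWeakDeriv.hasFDerivAt_mollify [CompleteSpace W] {U : Set V} (hU : MeasurableSet U)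
    {f : V → W} {g : V → V →L[ℝ] W} (h : HasWeakDeriv U f g) (hf : Integrable (U.indicator f))
    (hg : Integrable (U.indicator g)) (φ : ContDiffBump (0 : V)) {x : V}
    (hx : closedBall x φ.rOut ⊆ U) :
    HasFDerivAt (mollify φ U f) (mollify φ U g x) x := by
  set η := φ.normed (volume : Measure V) with hη
  have hηs : ContDiff ℝ ∞ η := φ.contDiff_normed
  have hηc : HasCompactSupport η := φ.hasCompactSupport_normed
  have hη1 : ContDiff ℝ 1 η := φ.contDiff_normed (n := 1)
  have hmain := hηc.hasFDerivAt_convolution_left (lsmul ℝ ℝ) hη1 hf.locallyIntegrable x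
  have hsupp : ∀ t, t ∉ closedBall x φ.rOut → η (x - t) = 0 := by
    intro t ht
    have : x - t ∉ Function.support η := by
      rw [hη, φ.support_normed_eq, mem_ball_zero_iff]
      rw [mem_closedBall, dist_comm, dist_eq_norm] at ht
      linarith
    simpa using this
  -- The reflected bump t ↦ η(x - t) is the test function. The sign from differentiating the
  -- reflection cancels the sign in the definition of the weak derivative.
  have hψ : ContDiff ℝ ∞ fun t => η (x - t) := hηs.comp (contDiff_const.sub contDiff_id)
  have hψc : HasCompactSupport fun t => η (x - t) :=
    HasCompactSupport.intro (isCompact_closedBall x φ.rOut) hsupp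
  have hψU : tsupport (fun t => η (x - t)) ⊆ U := by
    refine (closure_minimal ?_ isClosed_closedBall).trans hx
    intro t ht
    by_contra hcon
    exact ht (hsupp t hcon)
  have hfd : ∀ t v, fderiv ℝ (fun t => η (x - t)) t v = -fderiv ℝ η (x - t) v := by
    intro t v
    have := (hη1.differentiable one_ne_zero (x - t)).hasFDerivAt.comp t
      ((hasFDerivAt_id t).const_sub x)
    change HasFDerivAt (fun t => η (x - t)) _ t at this
    rw [this.fderiv]
    simp
  refine hmain.congr_fderiv (Eq.symm ?_)
  ext v
  have hint1 : Integrable fun t => ((lsmul ℝ ℝ).precompL V (fderiv ℝ η (x - t)))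
      (U.indicator f t) :=
    ((hηc.fderiv (𝕜 := ℝ)).convolutionExists_left ((lsmul ℝ ℝ : ℝ →L[ℝ] W →L[ℝ] W).precompL V)
      (hη1.continuous_fderiv one_ne_zero) hf.locallyIntegrable x).integrable_swap
  have hint2 : Integrable fun t => (lsmul ℝ ℝ (η (x - t))) (U.indicator g t) :=
    (hηc.convolutionExists_left (lsmul ℝ ℝ : ℝ →L[ℝ] (V →L[ℝ] W) →L[ℝ] (V →L[ℝ] W))
      hη1.continuous hg.locallyIntegrable x).integrable_swap
  rw [mollify, convolution_eq_swap, convolution_eq_swap, integral_apply hint1, integral_apply hint2]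
  have hweak := h.2.2 _ hψ hψc hψU v
  simp only [hfd, neg_smul, integral_neg, neg_inj] at hweak
  rw [← integral_indicator hU, ← integral_indicator hU] at hweak
  convert hweak.symm using 1 <;>
  · congr 1
    ext t
    by_cases ht : t ∈ U <;> simp [ht, precompL_apply]

/-- Jensen's inequality for the probability measure with density `φ.normed`. The measurable
representative `F` makes the later exchange of integrals legitimate. -/
theorem enorm_mollify_rpow_le (φ : ContDiffBump (0 : V)) {U : Set V} {h : V → W}
    {F : V → ℝ≥0∞} (hFm : Measurable F) (hF : ∀ᵐ z, ‖U.indicator h z‖ₑ = F z) {q : ℝ}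
    (hq : 1 ≤ q) (z : V) :
    ‖mollify φ U h z‖ₑ ^ q ≤ ∫⁻ t, F (z - t) ^ q
      ∂(volume.withDensity fun t => ENNReal.ofReal (φ.normed volume t)) := by
  set γ := (volume : Measure V).withDensity fun t => ENNReal.ofReal (φ.normed volume t) with hγ
  have hφm : Measurable fun t => ENNReal.ofReal (φ.normed (volume : Measure V) t) :=
    φ.continuous_normed.measurable.ennreal_ofReal
  have hγ1 : γ univ = 1 := by
    rw [hγ, withDensity_apply _ .univ, setLIntegral_univ,
      ← ofReal_integral_eq_lintegral_ofReal φ.integrable_normed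
        (Eventually.of_forall φ.nonneg_normed), φ.integral_normed, ENNReal.ofReal_one]
  have h1 : ‖mollify φ U h z‖ₑ ≤ ∫⁻ t, F (z - t) ∂γ := by
    rw [mollify, convolution_def, hγ, lintegral_withDensity_eq_lintegral_mul _ hφm (by fun_prop)]
    refine (enorm_integral_le_lintegral_enorm _).trans (le_of_eq (lintegral_congr_ae ?_))
    have := (Measure.measurePreserving_sub_left volume z).quasiMeasurePreserving.ae hF
    filter_upwards [this] with t ht
    rw [lsmul_apply, enorm_smul, ht, Pi.mul_apply, Real.enorm_of_nonneg (φ.nonneg_normed t)]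
  have h2 := lintegral_le_rpow_lintegral_rpow (μ := γ) (f := fun t => F (z - t)) (by fun_prop) hq
  rw [hγ1, ENNReal.one_rpow, mul_one] at h2
  calc _ ≤ ((∫⁻ t, F (z - t) ^ q ∂γ) ^ (1 / q)) ^ q := by
        gcongr
        exact h1.trans h2
    _ = _ := by rw [← ENNReal.rpow_mul, one_div_mul_cancel (by linarith), ENNReal.rpow_one]

/-- Mollification averages translates by vectors shorter than `r`, and each such translate of the
ball stays in the ball of radius 2r. -/
theorem setLIntegral_mollify_rpow_le (φ : ContDiffBump (0 : V)) {U : Set V} {h : V → W}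
    (hh : AEStronglyMeasurable (U.indicator h)) {q : ℝ} (hq : 1 ≤ q) {x : V} {r : ℝ}
    (hr : φ.rOut ≤ r) :
    ∫⁻ z in ball x r, ‖mollify φ U h z‖ₑ ^ q ≤ ∫⁻ z in ball x (2 * r), ‖U.indicator h z‖ₑ ^ q := by
  set F := hh.enorm.mk _ with hFd
  have hFm : Measurable F := hh.enorm.measurable_mk
  have hF : ∀ᵐ z, ‖U.indicator h z‖ₑ = F z := hh.enorm.ae_eq_mk
  set γ := (volume : Measure V).withDensity fun t => ENNReal.ofReal (φ.normed volume t) with hγ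
  have hφm : Measurable fun t => ENNReal.ofReal (φ.normed (volume : Measure V) t) :=
    φ.continuous_normed.measurable.ennreal_ofReal
  have hγ1 : γ univ = 1 := by
    rw [hγ, withDensity_apply _ .univ, setLIntegral_univ,
      ← ofReal_integral_eq_lintegral_ofReal φ.integrable_normed
        (Eventually.of_forall φ.nonneg_normed), φ.integral_normed, ENNReal.ofReal_one]
  have : IsFiniteMeasure γ := ⟨by simp [hγ1]⟩
  have hγs : ∀ᵐ t ∂γ, t ∈ ball (0 : V) φ.rOut := by
    rw [hγ, ae_withDensity_iff hφm]
    refine Eventually.of_forall fun t ht => ?_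
    rw [← φ.support_normed_eq (μ := volume)]
    intro h0
    exact ht (by rw [h0, ENNReal.ofReal_zero])
  have hRHS : ∫⁻ z in ball x (2 * r), ‖U.indicator h z‖ₑ ^ q = ∫⁻ z in ball x (2 * r), F z ^ q := by
    refine setLIntegral_congr_fun_ae measurableSet_ball ?_
    filter_upwards [hF] with z hz _
    rw [hz]
  rw [hRHS]
  calc _ ≤ ∫⁻ z in ball x r, (∫⁻ t, F (z - t) ^ q ∂γ) :=
        lintegral_mono fun z => enorm_mollify_rpow_le φ hFm hF hq z
    _ = ∫⁻ t, (∫⁻ z in ball x r, F (z - t) ^ q) ∂γ :=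
        lintegral_lintegral_swap (by fun_prop)
    _ ≤ ∫⁻ t, (∫⁻ z in ball x (2 * r), F z ^ q) ∂γ := by
        refine lintegral_mono_ae ?_
        filter_upwards [hγs] with t ht
        rw [← lintegral_indicator measurableSet_ball, ← lintegral_indicator measurableSet_ball,
          ← lintegral_sub_right_eq_self (fun z => (ball x (2 * r)).indicator (fun z => F z ^ q) z) t]
        refine lintegral_mono fun z => ?_
        by_cases hz : z ∈ ball x r
        · have : z - t ∈ ball x (2 * r) := by
            rw [mem_ball, dist_eq_norm] at hz ⊢
            rw [mem_ball_zero_iff] at ht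
            calc ‖z - t - x‖ = ‖(z - x) - t‖ := by congr 1; abel
              _ ≤ ‖z - x‖ + ‖t‖ := norm_sub_le _ _
              _ < 2 * r := by linarith
          rw [indicator_of_mem hz, indicator_of_mem this]
        · rw [indicator_of_notMem hz]
          exact zero_le
    _ = _ := by rw [lintegral_const, hγ1, mul_one]

theorem tendsto_mollify_of_continuousAt {ι : Type*} {l : Filter ι} {φ : ι → ContDiffBump (0 : V)}
    (hφ : Tendsto (fun i => (φ i).rOut) l (𝓝 0)) [CompleteSpace W] {U : Set V} {f : V → W}
    (hf : AEStronglyMeasurable (U.indicator f)) {x : V} (hU : U ∈ 𝓝 x) (hc : ContinuousAt f x) :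
    Tendsto (fun i => mollify (φ i) U f x) l (𝓝 (f x)) := by
  have hc' : ContinuousAt (U.indicator f) x :=
    hc.congr (by filter_upwards [hU] with y hy using (indicator_of_mem hy f).symm)
  have h := ContDiffBump.convolution_tendsto_right (μ := volume) (g := fun _ => U.indicator f)
    (k := fun _ => x) (x₀ := x) (z₀ := U.indicator f x) hφ (Eventually.of_forall fun _ => hf)
    (hc'.tendsto.comp tendsto_snd) tendsto_const_nhds
  rw [indicator_of_mem (mem_of_mem_nhds hU)] at h
  exact h

/-- A sequence of bump functions shrinking to the origin. -/
noncomputable def shrinkingBump (V : Type*) [NormedAddCommGroup V] (k : ℕ) : ContDiffBump (0 : V) where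
  rIn := 1 / (k + 1)
  rOut := 2 / (k + 1)
  rIn_pos := by positivity
  rIn_lt_rOut := by gcongr; norm_num

omit [InnerProductSpace ℝ V] [FiniteDimensional ℝ V] [MeasurableSpace V] [BorelSpace V] in
theorem tendsto_shrinkingBump_rOut :
    Tendsto (fun k => (shrinkingBump V k).rOut) atTop (𝓝 0) := by
  have := (tendsto_one_div_add_atTop_nhds_zero_nat (𝕜 := ℝ)).const_mul 2
  simpa [shrinkingBump, div_eq_mul_inv] using this

theorem ae_tendsto_mollify_shrinkingBump [CompleteSpace W] {U : Set V} {g : V → W}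
    (hg : Integrable (U.indicator g)) :
    ∀ᵐ x, Tendsto (fun k => mollify (shrinkingBump V k) U g x) atTop (𝓝 (U.indicator g x)) :=
  ContDiffBump.ae_convolution_tendsto_right_of_locallyIntegrable (K := 2)
    tendsto_shrinkingBump_rOut (Eventually.of_forall fun k => by
      simp only [shrinkingBump]; exact le_of_eq (by ring)) hg.locallyIntegrable

end Mollify

/-! ### Second-order Taylor remainders of W^{2,p} functions. -/

section Taylor

set_option maxSynthPendingDepth 3

open Module Filter Topology

variable {V : Type*} [NormedAddCommGroup V] [InnerProductSpace ℝ V] [FiniteDimensional ℝ V]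
  [MeasurableSpace V] [BorelSpace V] {W : Type*} [NormedAddCommGroup W] [NormedSpace ℝ W]

/-- The right-hand side of Morrey's inequality on `ball x r`, with the integral taken over the
ball of twice the radius. -/
noncomputable def morreyBound (q : ℝ) (h : V → W) (x : V) (r : ℝ) : ℝ≥0∞ :=
  morreyConst V q * ENNReal.ofReal r *
    ((∫⁻ z in ball x (2 * r), ‖h z‖ₑ ^ q) / volume (ball x r)) ^ (1 / q)

-- Enlarging the integral to the whole space makes the bound uniform in the centre. The power of r
-- is positive when q > dim, which gives equicontinuity of the derivatives.
omit [NormedSpace ℝ W] in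
theorem morreyBound_le {q : ℝ} (hq : 0 < q) (h : V → W) (x : V) {r : ℝ} (hr : 0 < r) :
    morreyBound q h x r ≤ morreyConst V q *
      ((∫⁻ z, ‖h z‖ₑ ^ q) / volume (ball (0 : V) 1)) ^ (1 / q) *
        ENNReal.ofReal (r ^ (1 - (finrank ℝ V : ℝ) / q)) := by
  rw [morreyBound, Measure.addHaar_ball_of_pos _ x hr]
  have h0 : ENNReal.ofReal (r ^ finrank ℝ V) ≠ 0 := by
    rw [Ne, ENNReal.ofReal_eq_zero, not_le]; positivity
  set v := volume (ball (0 : V) 1)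
  set A := ∫⁻ z, ‖h z‖ₑ ^ q
  have e1 : (ENNReal.ofReal (r ^ finrank ℝ V))⁻¹ ^ (1 / q) =
      ENNReal.ofReal (r ^ (-((finrank ℝ V : ℝ) / q))) := by
    rw [← ENNReal.ofReal_inv_of_pos (by positivity), ENNReal.ofReal_rpow_of_nonneg (by positivity)
      (by positivity), ← Real.rpow_natCast, ← Real.rpow_neg hr.le, ← Real.rpow_mul hr.le]
    congr 2
    ring
  have e2 : ENNReal.ofReal r * ENNReal.ofReal (r ^ (-((finrank ℝ V : ℝ) / q))) =
      ENNReal.ofReal (r ^ (1 - (finrank ℝ V : ℝ) / q)) := by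
    rw [← ENNReal.ofReal_mul hr.le, sub_eq_add_neg, Real.rpow_add hr, Real.rpow_one]
  calc _ ≤ morreyConst V q * ENNReal.ofReal r *
        (A / (ENNReal.ofReal (r ^ finrank ℝ V) * v)) ^ (1 / q) := by
        gcongr
        exact setLIntegral_le_lintegral _ _
    _ = morreyConst V q * ENNReal.ofReal r *
        ((A / v) * (ENNReal.ofReal (r ^ finrank ℝ V))⁻¹) ^ (1 / q) := by
        congr 2
        rw [div_eq_mul_inv, ENNReal.mul_inv (Or.inl h0) (Or.inl ENNReal.ofReal_ne_top),
          div_eq_mul_inv]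
        ring
    _ = _ := by
        rw [ENNReal.mul_rpow_of_nonneg _ _ (by positivity), e1, ← e2]
        ring

omit [FiniteDimensional ℝ V] [MeasurableSpace V] [BorelSpace V] in
theorem tendsto_rpow_morrey {q : ℝ} (hq0 : 0 < q) (hq : finrank ℝ V < q) {A : ℝ≥0∞} (hA : A ≠ ⊤) :
    Tendsto (fun r : ℝ => A * ENNReal.ofReal (r ^ (1 - (finrank ℝ V : ℝ) / q))) (𝓝[>] 0)
      (𝓝 0) := by
  have hα : 0 < 1 - (finrank ℝ V : ℝ) / q := by rw [sub_pos, div_lt_one hq0]; exact hq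
  have h1 : Tendsto (fun r : ℝ => r ^ (1 - (finrank ℝ V : ℝ) / q)) (𝓝[>] 0) (𝓝 0) := by
    have := (Real.continuousAt_rpow_const 0 (1 - (finrank ℝ V : ℝ) / q) (Or.inr hα.le)).tendsto
    rw [Real.zero_rpow hα.ne'] at this
    exact this.mono_left nhdsWithin_le_nhds
  have h2 := ENNReal.Tendsto.const_mul (ENNReal.tendsto_ofReal h1) (Or.inr hA)
  simpa using h2

omit [NormedSpace ℝ W] in
theorem morreyBound_le_maximalFn {q : ℝ} (hq : 0 < q) (h : V → W) {ν : Measure V} {x : V}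
    {r ρ : ℝ} (hν : ∫⁻ z in ball x (2 * r), ‖h z‖ₑ ^ q ≤ ν (ball x (2 * r)))
    (hr : 0 < r) (hrρ : 2 * r ≤ ρ) :
    morreyBound q h x r ≤ morreyConst V q *
      (2 ^ finrank ℝ V * maximalFn volume ν ρ x) ^ (1 / q) * ENNReal.ofReal r := by
  rw [morreyBound, mul_right_comm]
  gcongr
  have hM : ν (ball x (2 * r)) / volume (ball x (2 * r)) ≤ maximalFn volume ν ρ x :=
    le_iSup₂_of_le (2 * r) ⟨by linarith, hrρ⟩ le_rfl
  refine le_trans ?_ (mul_le_mul_right hM _)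
  rw [Measure.addHaar_ball_mul_of_pos volume _ two_pos, ENNReal.ofReal_pow (by norm_num),
    Measure.addHaar_ball_center volume x, ENNReal.ofReal_ofNat, ← mul_div_assoc,
    ENNReal.mul_div_mul_left _ _ (by simp) (by finiteness)]
  gcongr

/-- The first bound is Morrey's inequality for the mollified derivative, and the second follows from
it by the mean value inequality. Neither depends on `φ` beyond `hφ`, so both survive the limit. -/
theorem norm_mollify_taylor_le [CompleteSpace W] {q : ℝ} (hq1 : 1 ≤ q) (hq : finrank ℝ V < q)
    {U : Set V} (hU : MeasurableSet U) {f : V → W} {g : V → V →L[ℝ] W} {h : V → V →L[ℝ] V →L[ℝ] W}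
    (hfg : HasWeakDeriv U f g) (hgh : HasWeakDeriv U g h) (hf : Integrable (U.indicator f))
    (hg : Integrable (U.indicator g)) (hh : Integrable (U.indicator h))
    (hfin : ∫⁻ z, ‖U.indicator h z‖ₑ ^ q < ⊤)
    {x z : V} {r : ℝ} (hr : 0 < r) (hz : z ∈ closedBall x r) {φ : ContDiffBump (0 : V)}
    (hφ : φ.rOut ≤ r) (hUr : closedBall x (2 * r) ⊆ U) :
    ‖mollify φ U g z - mollify φ U g x‖ₑ ≤ morreyBound q (U.indicator h) x r ∧
    ‖mollify φ U f z - mollify φ U f x - mollify φ U g x (z - x)‖ₑ ≤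
      morreyBound q (U.indicator h) x r * ‖z - x‖ₑ := by
  have hsub : ∀ w ∈ closedBall x r, closedBall w φ.rOut ⊆ U := fun w hw =>
    (closedBall_subset_closedBall' (by rw [mem_closedBall] at hw; linarith)).trans hUr
  have hM : ∀ w ∈ closedBall x r,
      ‖mollify φ U g w - mollify φ U g x‖ₑ ≤ morreyBound q (U.indicator h) x r := by
    intro w hw
    refine (enorm_sub_le_of_mem_closedBall volume (contDiff_mollify φ hg) hq1 hr hw
      (mem_closedBall_self hr.le)).trans ?_
    rw [morreyBound]
    gcongr morreyConst V q * _ * (?_ / _) ^ (1 / q)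
    refine le_trans (le_of_eq ?_) (setLIntegral_mollify_rpow_le φ hh.aestronglyMeasurable hq1 hφ)
    refine setLIntegral_congr_fun measurableSet_ball fun y hy => ?_
    rw [(hgh.hasFDerivAt_mollify hU hg hh φ (hsub y (ball_subset_closedBall hy))).fderiv]
  refine ⟨hM z hz, ?_⟩
  have hBt : morreyBound q (U.indicator h) x r ≠ ⊤ := by
    refine ((morreyBound_le (by linarith) _ x hr).trans_lt ?_).ne
    refine ENNReal.mul_lt_top (ENNReal.mul_lt_top (morreyConst_lt_top (by linarith) hq) ?_)
      ENNReal.ofReal_lt_top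
    refine ENNReal.rpow_lt_top_of_nonneg (by positivity) ?_
    exact ENNReal.div_ne_top hfin.ne (measure_ball_pos _ _ one_pos).ne'
  have hmvt := (convex_closedBall x r).norm_image_sub_le_of_norm_hasFDerivWithin_le'
    (f := mollify φ U f) (f' := mollify φ U g) (φ := mollify φ U g x)
    (C := (morreyBound q (U.indicator h) x r).toReal)
    (fun w hw => (hfg.hasFDerivAt_mollify hU hf hg φ (hsub w hw)).hasFDerivWithinAt)
    (fun w hw => by
      rw [← toReal_enorm]
      exact ENNReal.toReal_mono hBt (hM w hw)) (mem_closedBall_self hr.le) hz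
  rw [← ofReal_norm, ← ofReal_norm, ← ENNReal.ofReal_toReal hBt,
    ← ENNReal.ofReal_mul ENNReal.toReal_nonneg]
  exact ENNReal.ofReal_le_ofReal hmvt

/-- A continuous `W^{2,p}` function on a ball, `p > dim V`, is `C¹` and has pointwise second-order
Taylor remainders controlled by an `L^p` function. -/
theorem MemW2.exists_taylor [CompleteSpace W] {p R : ℝ} (hV : 0 < finrank ℝ V)
    (hp : finrank ℝ V < p) (hR : 0 < R) {f : V → W} (hW : MemW2 p (ball 0 (2 * R)) f)
    (hc : ContinuousOn f (ball 0 (2 * R))) :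
    ∃ (G : V → V →L[ℝ] W) (N : V → ℝ≥0∞), ContinuousOn G (ball 0 R) ∧ ∫⁻ x, N x ^ p < ⊤ ∧
      ∀ x ∈ ball (0 : V) R, HasFDerivAt f (G x) x ∧
        ∀ z, dist z x < R / 2 → ‖f z - f x - G x (z - x)‖ₑ ≤ N x * ‖z - x‖ₑ ^ 2 := by
  obtain ⟨g, h, hfg, hgh, hfp, hgp, hhp⟩ := hW
  set U := ball (0 : V) (2 * R) with hUd
  have hUm : MeasurableSet U := measurableSet_ball
  have hm1 : (1 : ℝ) ≤ finrank ℝ V := by exact_mod_cast hV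
  -- Morrey needs q > dim, and the maximal theorem needs exponent p/q > 1.
  obtain ⟨q, hmq, hqp⟩ := exists_between hp
  have hq1 : 1 ≤ q := by linarith
  have hq0 : 0 < q := by linarith
  have hp0 : 0 < p := by linarith
  have : IsFiniteMeasure (volume.restrict U) :=
    ⟨by rw [Measure.restrict_apply_univ]; exact measure_ball_lt_top⟩
  have hp1 : (1 : ℝ≥0∞) ≤ ENNReal.ofReal p := by
    rw [ENNReal.one_le_ofReal]; linarith
  have hf : Integrable (U.indicator f) :=
    (integrable_indicator_iff hUm).2 (memLp_one_iff_integrable.1 (hfp.mono_exponent hp1))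
  have hg : Integrable (U.indicator g) :=
    (integrable_indicator_iff hUm).2 (memLp_one_iff_integrable.1 (hgp.mono_exponent hp1))
  have hh : Integrable (U.indicator h) :=
    (integrable_indicator_iff hUm).2 (memLp_one_iff_integrable.1 (hhp.mono_exponent hp1))
  have hpow : ∀ s : ℝ, 0 < s → s ≤ p → ∫⁻ z, ‖U.indicator h z‖ₑ ^ s < ⊤ := by
    intro s hs hsp
    have h1 : MemLp h (ENNReal.ofReal s) (volume.restrict U) :=
      hhp.mono_exponent (ENNReal.ofReal_le_ofReal hsp)
    have h2 : MemLp (U.indicator h) (ENNReal.ofReal s) volume :=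
      (memLp_indicator_iff_restrict hUm).2 h1
    have := lintegral_rpow_enorm_lt_top_of_eLpNorm_lt_top (by simpa using hs)
      ENNReal.ofReal_ne_top h2.2
    rwa [ENNReal.toReal_ofReal hs.le] at this
  have hfin := hpow q hq0 hqp.le
  -- the sequence of mollifications
  set φ := shrinkingBump V with hφd
  have hφ0 : Tendsto (fun k => (φ k).rOut) atTop (𝓝 0) := tendsto_shrinkingBump_rOut
  have hφr : ∀ r : ℝ, 0 < r → ∀ᶠ k in atTop, (φ k).rOut ≤ r := fun r hr =>
    (hφ0.eventually (gt_mem_nhds hr)).mono fun k hk => hk.le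
  set B := morreyBound q (U.indicator h) with hB
  have hUr : ∀ x ∈ ball (0 : V) R, ∀ r, r < R / 2 → closedBall x (2 * r) ⊆ U := by
    intro x hx r hr
    refine (closedBall_subset_ball' ?_)
    rw [mem_ball] at hx
    linarith
  set A := morreyConst V q *
      ((∫⁻ z, ‖U.indicator h z‖ₑ ^ q) / volume (ball (0 : V) 1)) ^ (1 / q) with hA
  have hAt : A ≠ ⊤ := by
    refine (ENNReal.mul_lt_top (morreyConst_lt_top hq0 hmq) ?_).ne
    refine ENNReal.rpow_lt_top_of_nonneg (by positivity) ?_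
    exact ENNReal.div_ne_top hfin.ne (measure_ball_pos _ _ one_pos).ne'
  have hsmall : ∀ ε : ℝ≥0∞, 0 < ε → ∃ r, 0 < r ∧ r < R / 2 ∧ ∀ x, B x r ≤ ε := by
    intro ε hε
    have h1 := (tendsto_rpow_morrey (V := V) hq0 hmq hAt).eventually (gt_mem_nhds hε)
    have h2 : ∀ᶠ r in 𝓝[>] (0 : ℝ), r < R / 2 :=
      nhdsWithin_le_nhds (gt_mem_nhds (by positivity))
    obtain ⟨r, hr1, hr2, hr3⟩ := (h1.and (h2.and self_mem_nhdsWithin)).exists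
    exact ⟨r, hr3, hr2, fun x => (morreyBound_le hq0 _ x hr3).trans hr1.le⟩
  -- everywhere convergence of the mollified derivatives
  have hlim : ∀ x ∈ ball (0 : V) R, ∃ L, Tendsto (fun k => mollify (φ k) U g x) atTop (𝓝 L) := by
    intro x hx
    apply cauchySeq_tendsto_of_complete
    rw [EMetric.cauchySeq_iff]
    intro ε hε
    obtain ⟨r, hr0, hrR, hr⟩ := hsmall (ε / 4) (ENNReal.div_pos hε.ne' (by simp))
    obtain ⟨y, hy, hyr⟩ : ∃ y, Tendsto (fun k => mollify (φ k) U g y) atTop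
        (𝓝 (U.indicator g y)) ∧ y ∈ ball x r := by
      have h1 := ae_tendsto_mollify_shrinkingBump hg
      by_contra! hcon
      have h2 : ∀ᵐ y, y ∉ ball x r := by
        filter_upwards [h1] with y hy using hcon y hy
      have h3 : volume (ball x r) = 0 := measure_eq_zero_iff_ae_notMem.2 h2
      exact (measure_ball_pos volume x hr0).ne' h3
    have hcau := EMetric.cauchySeq_iff.1 hy.cauchySeq (ε / 4) (ENNReal.div_pos hε.ne' (by simp))
    obtain ⟨k0, hk0⟩ := hcau
    obtain ⟨k1, hk1⟩ := eventually_atTop.1 (hφr r hr0)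
    have key : ∀ k, k1 ≤ k → edist (mollify (φ k) U g y) (mollify (φ k) U g x) ≤ ε / 4 := by
      intro k hk
      rw [edist_eq_enorm_sub]
      exact ((norm_mollify_taylor_le hq1 hmq hUm hfg hgh hf hg hh hfin hr0
        (ball_subset_closedBall hyr) (hk1 k hk) (hUr x hx r hrR)).1).trans (hr x)
    rcases eq_or_ne ε ⊤ with rfl | hεt
    · exact ⟨0, fun _ _ _ _ => edist_lt_top _ _⟩
    refine ⟨max k0 k1, fun a ha b hb => ?_⟩
    have ha0 := le_of_max_le_left ha
    have ha1 := le_of_max_le_right ha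
    have hb0 := le_of_max_le_left hb
    have hb1 := le_of_max_le_right hb
    calc edist (mollify (φ a) U g x) (mollify (φ b) U g x)
        ≤ edist (mollify (φ a) U g x) (mollify (φ a) U g y) +
          edist (mollify (φ a) U g y) (mollify (φ b) U g y) +
          edist (mollify (φ b) U g y) (mollify (φ b) U g x) := edist_triangle4 _ _ _ _
      _ ≤ ε / 4 + ε / 4 + ε / 4 := by
          gcongr
          · rw [edist_comm]; exact key a ha1
          · exact (hk0 a ha0 b hb0).le
          · exact key b hb1
      _ < ε / 4 + ε / 4 + ε / 4 + ε / 4 := by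
          apply ENNReal.lt_add_right
          · finiteness
          · exact (ENNReal.div_pos hε.ne' (by simp)).ne'
      _ = ε := by
          rw [← ENNReal.toReal_eq_toReal_iff' (by finiteness) hεt]
          rw [ENNReal.toReal_add (by finiteness) (by finiteness),
            ENNReal.toReal_add (by finiteness) (by finiteness),
            ENNReal.toReal_add (by finiteness) (by finiteness), ENNReal.toReal_div]
          simp only [ENNReal.toReal_ofNat]
          ring
  choose! G hG using hlim
  have hflim : ∀ x ∈ U, Tendsto (fun k => mollify (φ k) U f x) atTop (𝓝 (f x)) := fun x hx =>
    tendsto_mollify_of_continuousAt hφ0 hf.aestronglyMeasurable (isOpen_ball.mem_nhds hx)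
      (hc.continuousAt (isOpen_ball.mem_nhds hx))
  have hUR : ball (0 : V) R ⊆ U := ball_subset_ball (by linarith)
  have hGlim : ∀ x ∈ ball (0 : V) R, ∀ r, 0 < r → r < R / 2 → ∀ z ∈ closedBall x r,
      z ∈ ball (0 : V) R → ‖G z - G x‖ₑ ≤ B x r := by
    intro x hx r hr hrR z hz hzR
    refine le_of_tendsto (((hG z hzR).sub (hG x hx)).enorm) ?_
    filter_upwards [hφr r hr] with k hk
    exact (norm_mollify_taylor_le hq1 hmq hUm hfg hgh hf hg hh hfin hr hz hk (hUr x hx r hrR)).1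
  have hTlim : ∀ x ∈ ball (0 : V) R, ∀ r, 0 < r → r < R / 2 → ∀ z ∈ closedBall x r,
      ‖f z - f x - G x (z - x)‖ₑ ≤ B x r * ‖z - x‖ₑ := by
    intro x hx r hr hrR z hz
    have hzU : z ∈ U := hUr x hx r hrR (closedBall_subset_closedBall (by linarith) hz)
    refine le_of_tendsto ((((hflim z hzU).sub (hflim x (hUR hx))).sub
      (((ContinuousLinearMap.apply ℝ W (z - x)).continuous.tendsto _).comp (hG x hx))).enorm) ?_
    filter_upwards [hφr r hr] with k hk
    exact (norm_mollify_taylor_le hq1 hmq hUm hfg hgh hf hg hh hfin hr hz hk (hUr x hx r hrR)).2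
  -- the `L^p` bound
  have hhm := hh.aestronglyMeasurable
  set ψ : V → ℝ := fun z => ‖hhm.mk _ z‖ ^ q with hψ
  have hψm : Measurable ψ := hhm.stronglyMeasurable_mk.norm.measurable.pow_const q
  have hψe : ∀ᵐ z, ENNReal.ofReal (ψ z) = ‖U.indicator h z‖ₑ ^ q := by
    filter_upwards [hhm.ae_eq_mk] with z hz
    rw [hz, hψ, ← ENNReal.ofReal_rpow_of_nonneg (norm_nonneg _) hq0.le, ofReal_norm]
  set ν := (volume : Measure V).withDensity fun z => ENNReal.ofReal (ψ z) with hν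
  set N : V → ℝ≥0∞ := fun x => morreyConst V q *
      (2 ^ finrank ℝ V * maximalFn volume ν R x) ^ (1 / q) with hN
  have hνball : ∀ x r, ∫⁻ z in ball x (2 * r), ‖U.indicator h z‖ₑ ^ q ≤ ν (ball x (2 * r)) := by
    intro x r
    rw [hν, withDensity_apply _ measurableSet_ball]
    exact le_of_eq (lintegral_congr_ae (ae_restrict_of_ae (hψe.mono fun z hz => hz.symm)))
  refine ⟨G, N, ?_, ?_, fun x hx => ⟨?_, ?_⟩⟩
  · intro x hx
    refine ContinuousAt.continuousWithinAt (EMetric.tendsto_nhds.2 fun ε hε => ?_)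
    obtain ⟨ε', hε', hlt⟩ := exists_between hε
    obtain ⟨r, hr0, hrR, hr⟩ := hsmall ε' hε'
    filter_upwards [closedBall_mem_nhds x hr0, isOpen_ball.mem_nhds hx] with z hz hzR
    rw [edist_eq_enorm_sub]
    exact ((hGlim x hx r hr0 hrR z hz hzR).trans (hr x)).trans_lt hlt
  · have hqs : 1 < p / q := by rwa [one_lt_div hq0]
    have h1 : ∫⁻ z, ENNReal.ofReal (ψ z) < ⊤ := by
      rwa [lintegral_congr_ae hψe]
    have h2 : ∫⁻ z, ENNReal.ofReal (ψ z) ^ (p / q) < ⊤ := by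
      have : ∀ᵐ z, ENNReal.ofReal (ψ z) ^ (p / q) = ‖U.indicator h z‖ₑ ^ p := by
        filter_upwards [hψe] with z hz
        rw [hz, ← ENNReal.rpow_mul, mul_div_cancel₀ p hq0.ne']
      rw [lintegral_congr_ae this]
      exact hpow p hp0 le_rfl
    have h3 := lintegral_maximalFn_rpow_lt_top volume R hqs hψm (fun z => by positivity) h1 h2
    have h4 : ∀ x, N x ^ p = morreyConst V q ^ p * (2 ^ finrank ℝ V) ^ (p / q) *
        maximalFn volume ν R x ^ (p / q) := by
      intro x
      rw [hN]
      simp only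
      rw [ENNReal.mul_rpow_of_nonneg _ _ hp0.le, ← ENNReal.rpow_mul, one_div_mul_eq_div,
        ENNReal.mul_rpow_of_nonneg _ _ (by positivity), mul_assoc]
    simp only [h4]
    have hK : morreyConst V q ^ p * (2 ^ finrank ℝ V) ^ (p / q) < ⊤ :=
      ENNReal.mul_lt_top
        (ENNReal.rpow_lt_top_of_nonneg hp0.le (morreyConst_lt_top hq0 hmq).ne)
        (ENNReal.rpow_lt_top_of_nonneg (by positivity) (by finiteness))
    rw [lintegral_const_mul' _ _ hK.ne]
    exact ENNReal.mul_lt_top hK h3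
  · refine HasFDerivAt.of_isLittleO (Asymptotics.isLittleO_iff.2 fun c hc0 => ?_)
    obtain ⟨r, hr0, hrR, hr⟩ := hsmall (ENNReal.ofReal c) (by simpa using hc0)
    filter_upwards [closedBall_mem_nhds x hr0] with z hz
    have := (hTlim x hx r hr0 hrR z hz).trans (mul_le_mul_left (hr x) _)
    rw [← ofReal_norm, ← ofReal_norm, ← ENNReal.ofReal_mul hc0.le] at this
    exact (ENNReal.ofReal_le_ofReal_iff (by positivity)).1 this
  · intro z hz
    rcases eq_or_ne z x with rfl | hne
    · simp
    have hr0 : 0 < dist z x := dist_pos.2 hne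
    -- With r = |z - x|, the factor r in the Morrey bound supplies the second power of |z - x|.
    refine (hTlim x hx (dist z x) hr0 hz z (mem_closedBall.2 le_rfl)).trans ?_
    have := morreyBound_le_maximalFn hq0 (U.indicator h) (ρ := R) (hνball x (dist z x)) hr0
      (by linarith)
    refine (mul_le_mul_left this _).trans (le_of_eq ?_)
    rw [dist_eq_norm, ofReal_norm, hN]
    ring

end Taylor

/-! ### Volumes of simplices, and measurability of the Menger curvature. -/

section Simplex

open Module Filter Topology

variable {n m : ℕ}

local notation "E" => EuclideanSpace ℝ (Fin n)

theorem hausdorffMeasure_convexHull_eq_zero {x : Fin (m + 2) → E} (hx : ¬AffineIndependent ℝ x) :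
    Measure.hausdorffMeasure ((m + 1 : ℕ) : ℝ) (convexHull ℝ (range x)) = 0 := by
  have h := hausdorffMeasure_of_dimH_lt (d := ((m + 1 : ℕ) : NNReal))
    (s := convexHull ℝ (range x)) ?_
  · simpa using h
  · rw [Real.Convex.dimH_eq_finrank_vectorSpan (convex_convexHull ℝ _)
      ((range_nonempty x).convexHull), ← direction_affineSpan, affineSpan_convexHull,
      direction_affineSpan]
    have h1 := finrank_vectorSpan_range_le ℝ x (n := m + 1) (by simp)
    have h2 : finrank ℝ (vectorSpan ℝ (range x)) ≠ m + 1 := fun h =>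
      hx ((affineIndependent_iff_finrank_vectorSpan_eq ℝ x (by simp)).2 h)
    exact_mod_cast lt_of_le_of_ne h1 h2

/-- A simplex in a slab of half-width `ε` around an `m`-plane, with diameter at most `d`, has small
`(m + 1)`-volume. -/
theorem hausdorffMeasure_convexHull_le {x : Fin (m + 2) → E} {T : Submodule ℝ E}
    (hT : finrank ℝ T ≤ m) {d ε : ℝ} (hd : ∀ i, ‖x i - x 0‖ ≤ d)
    (hε : ∀ i, ∃ t ∈ T, ‖x i - x 0 - t‖ ≤ ε) :
    Measure.hausdorffMeasure ((m + 1 : ℕ) : ℝ) (convexHull ℝ (range x)) ≤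
      (m + 1) ^ (m + 1) * (ENNReal.ofReal (2 * ε) * ENNReal.ofReal (2 * d) ^ m) := by
  by_cases hx : AffineIndependent ℝ x
  swap
  · rw [hausdorffMeasure_convexHull_eq_zero hx]; exact zero_le
  set S := vectorSpan ℝ (range x) with hS
  have hSf : finrank ℝ S = m + 1 := hx.finrank_vectorSpan (by simp)
  have hxS : ∀ i, x i - x 0 ∈ S := fun i =>
    vsub_mem_vectorSpan ℝ (mem_range_self i) (mem_range_self 0)
  -- The dimensions of `S` and `Tᗮ` add up to at least (m + 1) + (n - m) > n. Along such a direction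
  -- the simplex has only width ε on either side of `x 0`.
  obtain ⟨w, hw, hw0⟩ : ∃ w ∈ S ⊓ Tᗮ, w ≠ 0 := by
    apply Submodule.exists_mem_ne_zero_of_ne_bot
    intro hbot
    have h1 := Submodule.finrank_sup_add_finrank_inf_eq S Tᗮ
    have h2 := T.finrank_add_finrank_orthogonal
    have h3 := (S ⊔ Tᗮ).finrank_le
    rw [hbot, finrank_bot] at h1
    omega
  have hwn : ‖w‖ ≠ 0 := norm_ne_zero_iff.2 hw0
  set ν : S := ⟨‖w‖⁻¹ • w, S.smul_mem _ hw.1⟩ with hν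
  have hν1 : ‖ν‖ = 1 := by
    rw [hν, Submodule.coe_norm, norm_smul, norm_inv, norm_norm, inv_mul_cancel₀ hwn]
  have hνT : ∀ t ∈ T, inner ℝ (ν : E) t = 0 := by
    intro t ht
    rw [hν]
    simp only
    rw [inner_smul_left, Submodule.inner_left_of_mem_orthogonal ht hw.2, mul_zero]
  have horth : Orthonormal ℝ (({0} : Set (Fin (m + 1))).domRestrict fun _ => ν) := by
    refine ⟨fun _ => hν1, fun i j hij => ?_⟩
    exact absurd (Subsingleton.elim i j) hij
  obtain ⟨b, hb⟩ := horth.exists_orthonormalBasis_extension_of_card_eq (by simpa using hSf)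
  have hb0 : b 0 = ν := hb 0 rfl
  let L : (Fin (m + 1) → ℝ) →ₗ[ℝ] E :=
    { toFun := fun c => ∑ i, c i • (b i : E)
      map_add' := fun c c' => by simp [add_smul, Finset.sum_add_distrib]
      map_smul' := fun r c => by simp [Finset.smul_sum, mul_smul] }
  have hLle : ∀ c, ‖L c‖ ≤ (m + 1) * ‖c‖ := by
    intro c
    change ‖∑ i, c i • (b i : E)‖ ≤ _
    calc _ ≤ ∑ i, ‖c i • (b i : E)‖ := norm_sum_le _ _
      _ ≤ ∑ i : Fin (m + 1), ‖c‖ := by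
          refine Finset.sum_le_sum fun i _ => ?_
          rw [norm_smul, ← Submodule.coe_norm, b.orthonormal.1 i, mul_one]
          exact norm_le_pi_norm c i
      _ = _ := by simp
  -- The coordinate box carries the sup norm, for which Hausdorff measure is Lebesgue measure; this
  -- costs the crude Lipschitz constant m + 1.
  have hLip : LipschitzWith (m + 1 : NNReal) fun c => x 0 + L c := by
    refine LipschitzWith.of_dist_le_mul fun c c' => ?_
    rw [dist_add_left, dist_eq_norm, ← map_sub, dist_eq_norm]
    simpa using hLle (c - c')
  set a : Fin (m + 1) → ℝ := fun i => if i = 0 then ε else d with ha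
  have hsub : convexHull ℝ (range x) ⊆ (fun c => x 0 + L c) '' Icc (-a) a := by
    have hconv : Convex ℝ ((fun c => x 0 + L c) '' Icc (-a) a) := by
      have := ((convex_Icc (-a) a).linear_image L).translate (x 0)
      rwa [image_image] at this
    refine convexHull_min ?_ hconv
    rintro _ ⟨i, rfl⟩
    set y : S := ⟨x i - x 0, hxS i⟩ with hy
    refine ⟨fun j => inner ℝ (b j) y, ?_, ?_⟩
    · have habs : ∀ j, |inner ℝ (b j) y| ≤ a j := by
        intro j
        change _ ≤ if j = 0 then ε else d
        split_ifs with hj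
        · obtain ⟨t, ht, hle⟩ := hε i
          have : inner ℝ (b j) y = inner ℝ (ν : E) (x i - x 0 - t) := by
            rw [hj, hb0, inner_sub_right _ _ t, hνT t ht, sub_zero]
            rfl
          rw [this]
          refine (abs_real_inner_le_norm _ _).trans ?_
          rw [← Submodule.coe_norm, hν1, one_mul]
          exact hle
        · refine (abs_real_inner_le_norm _ _).trans ?_
          rw [b.orthonormal.1 j, one_mul]
          exact hd i
      exact ⟨fun j => (abs_le.1 (habs j)).1, fun j => (abs_le.1 (habs j)).2⟩
    · have h := congrArg (Subtype.val : S → E) (b.sum_repr' y)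
      simp only [Submodule.coe_sum, Submodule.coe_smul] at h
      change x 0 + ∑ j, inner ℝ (b j) y • (b j : E) = x i
      rw [h, hy]
      simp
  refine (measure_mono hsub).trans
    ((hLip.hausdorffMeasure_image_le (Nat.cast_nonneg _) _).trans ?_)
  have hvol := hausdorffMeasure_pi_real (ι := Fin (m + 1))
  rw [Fintype.card_fin] at hvol
  rw [hvol, Real.volume_Icc_pi, ENNReal.rpow_natCast]
  refine le_of_eq ?_
  push_cast
  congr 1
  rw [Fin.prod_univ_succ]
  simp only [ha, Pi.neg_apply, if_true, sub_neg_eq_add, ← two_mul, Fin.succ_ne_zero, if_false,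
    Finset.prod_const, Finset.card_univ, Fintype.card_fin]

/-- This is the linear part of the barycentric coordinate of the vertex `x 0`, extended to the whole
space. -/
theorem exists_linearMap_of_affineIndependent {x : Fin (m + 2) → E} (hx : AffineIndependent ℝ x) :
    ∃ l : E →L[ℝ] ℝ, l (x 0 - x 1) = 1 ∧ ∀ i, i ≠ 0 → l (x i - x 1) = 0 := by
  have h1 := (affineIndependent_iff_linearIndependent_vsub ℝ x 1).1 hx
  set v := fun i : {i : Fin (m + 2) // i ≠ 1} => x i -ᵥ x 1 with hv
  obtain ⟨l, hl⟩ := LinearMap.exists_extend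
    ((Basis.span h1).constr ℝ fun i : {i : Fin (m + 2) // i ≠ 1} => if i.1 = 0 then (1 : ℝ) else 0)
  have hlv : ∀ i : {i : Fin (m + 2) // i ≠ 1}, l (v i) = if i.1 = 0 then (1 : ℝ) else 0 := by
    intro i
    have h2 := LinearMap.congr_fun hl (Basis.span h1 i)
    rw [Basis.constr_basis, LinearMap.comp_apply, Submodule.subtype_apply, Basis.span_apply] at h2
    exact h2
  refine ⟨l.toContinuousLinearMap, ?_, fun i hi => ?_⟩
  · have := hlv ⟨0, by simp⟩
    rw [if_pos rfl] at this
    exact this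
  · by_cases h : i = 1
    · simp [h]
    · have := hlv ⟨i, h⟩
      rw [if_neg hi] at this
      exact this

/-- Moving one vertex of a nondegenerate simplex is realised by an affine map that fixes the other
vertices and is close to the identity. Its antilipschitz constant tends to 1, so the volume cannot
drop suddenly. Degenerate simplices have measure zero, where there is nothing to prove. -/
theorem lowerSemicontinuous_hausdorffMeasure_convexHull (y : Fin (m + 1) → E) :
    LowerSemicontinuous fun x : E => Measure.hausdorffMeasure ((m + 1 : ℕ) : ℝ)
      (convexHull ℝ (range (Fin.cons x y : Fin (m + 2) → E))) := by
  intro x c hc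
  by_cases hx : AffineIndependent ℝ (Fin.cons x y : Fin (m + 2) → E)
  swap
  · simp only [hausdorffMeasure_convexHull_eq_zero hx] at hc
    exact absurd hc not_lt_zero
  obtain ⟨l, hl1, hl0⟩ := exists_linearMap_of_affineIndependent hx
  have he : (Fin.cons x y : Fin (m + 2) → E) 1 = y 0 := rfl
  rw [he, Fin.cons_zero] at hl1
  have hly : ∀ i, l (y i - y 0) = 0 := fun i => by
    have := hl0 i.succ (Fin.succ_ne_zero i)
    rwa [he, Fin.cons_succ] at this
  let T : E → E →ᵃ[ℝ] E := fun δ =>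
    { toFun := fun w => w + l (w - y 0) • δ
      linear := LinearMap.id + (l : E →ₗ[ℝ] ℝ).smulRight δ
      map_vadd' := fun p v => by
        simp only [vadd_eq_add, LinearMap.add_apply, LinearMap.id_apply, LinearMap.smulRight_apply,
          ContinuousLinearMap.coe_coe]
        rw [add_sub_assoc, map_add, add_smul]
        abel }
  have hT : ∀ x', T (x' - x) '' convexHull ℝ (range (Fin.cons x y : Fin (m + 2) → E)) =
      convexHull ℝ (range (Fin.cons x' y : Fin (m + 2) → E)) := by
    intro x'
    rw [AffineMap.image_convexHull, ← range_comp]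
    congr 2
    ext1 i
    refine Fin.cases ?_ (fun i => ?_) i
    · change x + l (x - y 0) • (x' - x) = x'
      rw [hl1, one_smul, add_sub_cancel]
    · change y i + l (y i - y 0) • (x' - x) = y i
      rw [hly, zero_smul, add_zero]
  -- The subtraction is truncated, but agrees with the real one for `x'` near `x`.
  set K : E → NNReal := fun x' => (1 - ‖l‖₊ * ‖x' - x‖₊)⁻¹ with hK
  have hanti : ∀ᶠ x' in 𝓝 x, AntilipschitzWith (K x') (T (x' - x)) := by
    have hlim : Tendsto (fun x' => ‖l‖ * ‖x' - x‖) (𝓝 x) (𝓝 0) := by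
      have : Continuous fun x' => ‖l‖ * ‖x' - x‖ := by fun_prop
      simpa using this.tendsto x
    filter_upwards [hlim.eventually (gt_mem_nhds one_pos)] with x' hx'
    refine AntilipschitzWith.of_le_mul_dist fun w w' => ?_
    have hpos : 0 < 1 - ‖l‖ * ‖x' - x‖ := by linarith
    have hKc : (K x' : ℝ) = (1 - ‖l‖ * ‖x' - x‖)⁻¹ := by
      rw [hK]
      push_cast
      rw [NNReal.coe_sub]
      · simp
      · rw [← NNReal.coe_le_coe]; simpa using hx'.le
    rw [hKc, inv_mul_eq_div, le_div_iff₀ hpos, dist_eq_norm, dist_eq_norm]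
    have hsub : T (x' - x) w - T (x' - x) w' = (w - w') + l (w - w') • (x' - x) := by
      change w + l (w - y 0) • (x' - x) - (w' + l (w' - y 0) • (x' - x)) = _
      have : l (w - y 0) = l (w - w') + l (w' - y 0) := by rw [← map_add, sub_add_sub_cancel]
      rw [this, add_smul]
      abel
    rw [hsub]
    have h1 : ‖l (w - w') • (x' - x)‖ ≤ ‖l‖ * ‖w - w'‖ * ‖x' - x‖ := by
      rw [norm_smul]
      gcongr
      exact l.le_opNorm _
    have h2 := norm_sub_le ((w - w') + l (w - w') • (x' - x)) (l (w - w') • (x' - x))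
    rw [add_sub_cancel_right] at h2
    linarith
  have hKlim : Tendsto (fun x' => c * (K x' : ℝ≥0∞) ^ (m + 1)) (𝓝 x) (𝓝 c) := by
    have h1 : Tendsto K (𝓝 x) (𝓝 1) := by
      have h2 : Tendsto (fun x' => 1 - ‖l‖₊ * ‖x' - x‖₊) (𝓝 x) (𝓝 1) := by
        have : Continuous fun x' => 1 - ‖l‖₊ * ‖x' - x‖₊ := by fun_prop
        simpa using this.tendsto x
      simpa using h2.inv₀ one_ne_zero
    have h3 : Tendsto (fun x' => (K x' : ℝ≥0∞) ^ (m + 1)) (𝓝 x) (𝓝 1) := by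
      have := ENNReal.Tendsto.pow (n := m + 1) (ENNReal.tendsto_coe.2 h1)
      simpa using this
    simpa using ENNReal.Tendsto.const_mul h3 (Or.inl one_ne_zero)
  filter_upwards [hanti, hKlim.eventually (gt_mem_nhds hc)] with x' h1 h2
  have h3 := h1.le_hausdorffMeasure_image (d := ((m + 1 : ℕ) : ℝ)) (Nat.cast_nonneg _)
    (convexHull ℝ (range (Fin.cons x y : Fin (m + 2) → E)))
  rw [hT, ENNReal.rpow_natCast, mul_comm] at h3
  exact lt_of_mul_lt_mul_right' (h2.trans_le h3)

theorem ediam_range_cons_le (y : Fin (m + 1) → E) (x x' : E) :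
    ediam (range (Fin.cons x' y : Fin (m + 2) → E)) ≤
      ediam (range (Fin.cons x y : Fin (m + 2) → E)) + edist x' x := by
  have hm : ∀ i, (Fin.cons x y : Fin (m + 2) → E) i ∈ range (Fin.cons x y : Fin (m + 2) → E) :=
    mem_range_self
  have hxy : ∀ i, edist x (y i) ≤ ediam (range (Fin.cons x y : Fin (m + 2) → E)) := fun i =>
    edist_le_ediam_of_mem (hm 0) (hm i.succ)
  have hyy : ∀ i j, edist (y i) (y j) ≤ ediam (range (Fin.cons x y : Fin (m + 2) → E)) :=
    fun i j => edist_le_ediam_of_mem (hm i.succ) (hm j.succ)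
  have hx'y : ∀ i, edist x' (y i) ≤
      ediam (range (Fin.cons x y : Fin (m + 2) → E)) + edist x' x := fun i => by
    rw [add_comm]
    exact (edist_triangle x' x (y i)).trans (by gcongr; exact hxy i)
  refine ediam_le ?_
  rintro _ ⟨i, rfl⟩ _ ⟨j, rfl⟩
  refine Fin.cases ?_ (fun i => ?_) i <;> refine Fin.cases ?_ (fun j => ?_) j <;>
    simp only [Fin.cons_zero, Fin.cons_succ]
  · simp
  · exact hx'y j
  · rw [edist_comm]; exact hx'y i
  · exact (hyy i j).trans le_self_add

theorem ediam_range_ne_top (x : Fin (m + 2) → E) : ediam (range x) ≠ ⊤ :=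
  (finite_range x).isBounded.ediam_ne_top

theorem hausdorff_apply (d : ℕ) (s : Set E) : hausdorff d s =
    volume (ball (0 : EuclideanSpace ℝ (Fin d)) (1 / 2)) * Measure.hausdorffMeasure (d : ℝ) s := by
  simp [hausdorff]

theorem lowerSemicontinuous_mengerK (y : Fin (m + 1) → E) :
    LowerSemicontinuous fun x : E => mengerK m (Fin.cons x y) := by
  intro x c hc
  set κ := volume (ball (0 : EuclideanSpace ℝ (Fin (m + 1))) (1 / 2)) with hκ
  have hκ0 : κ ≠ 0 := (measure_ball_pos _ _ (by norm_num)).ne'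
  have hκt : κ ≠ ⊤ := measure_ball_lt_top.ne
  simp only [mengerK, hausdorff_apply] at hc ⊢
  rw [← hκ] at hc ⊢
  set b := ediam (range (Fin.cons x y : Fin (m + 2) → E)) with hb
  have hbt : b ≠ ⊤ := ediam_range_ne_top _
  have hct : c ≠ ⊤ := hc.ne_top
  -- Multiplying out, with `c` finite, also covers diameter zero.
  rw [gt_iff_lt, ENNReal.lt_div_iff_mul_lt (Or.inr hct) (Or.inl (by finiteness))] at hc
  obtain ⟨r, hr1, hr2⟩ := exists_between hc
  have h1 : r / κ < Measure.hausdorffMeasure ((m + 1 : ℕ) : ℝ)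
      (convexHull ℝ (range (Fin.cons x y : Fin (m + 2) → E))) := by
    rwa [ENNReal.div_lt_iff (Or.inl hκ0) (Or.inl hκt), mul_comm]
  have h2 : Tendsto (fun x' => c * (b + edist x' x) ^ (m + 2)) (𝓝 x) (𝓝 (c * b ^ (m + 2))) := by
    have h3 : Tendsto (fun x' => b + edist x' x) (𝓝 x) (𝓝 b) := by
      have : Continuous fun x' => b + edist x' x := by fun_prop
      simpa using this.tendsto x
    exact ENNReal.Tendsto.const_mul (ENNReal.Tendsto.pow h3) (Or.inr hct)
  filter_upwards [lowerSemicontinuous_hausdorffMeasure_convexHull y x _ h1,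
    h2.eventually (gt_mem_nhds hr1)] with x' h3 h4
  have hbt' := ediam_range_ne_top (Fin.cons x' y : Fin (m + 2) → E)
  rw [gt_iff_lt, ENNReal.lt_div_iff_mul_lt (Or.inr hct) (Or.inl (by finiteness))]
  rw [gt_iff_lt, ENNReal.div_lt_iff (Or.inl hκ0) (Or.inl hκt), mul_comm] at h3
  refine lt_of_le_of_lt ?_ (h4.trans h3)
  gcongr
  exact ediam_range_cons_le y x x'

theorem measurable_globalMenger (S : Set E) : Measurable (globalMenger m S) :=
  (lowerSemicontinuous_biSup fun y _ => lowerSemicontinuous_mengerK y).measurable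

end Simplex

/-! ### Graph charts with Taylor control, and their tangent planes. -/

section Chart

set_option maxSynthPendingDepth 3

open Module Filter Topology

variable {n m : ℕ}

local notation "E" => EuclideanSpace ℝ (Fin n)

/-- The linear map `v ↦ v + A v`, which parametrises the graph of `A`. -/
noncomputable def graphMap (P : Submodule ℝ E) (A : P →L[ℝ] Pᗮ) : P →L[ℝ] E :=
  P.subtypeL + Pᗮ.subtypeL ∘L A

theorem graphMap_apply (P : Submodule ℝ E) (A : P →L[ℝ] Pᗮ) (v : P) :
    graphMap P A v = (v : E) + (A v : E) := rfl

/-- The parametrisation `z ↦ x + (z + f z)` of a translated graph. -/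
def graphPoint (P : Submodule ℝ E) (x : E) (f : P → Pᗮ) (z : P) : E := x + ((z : E) + (f z : E))

theorem orthogonalProjectionOnto_add_orthogonal (P : Submodule ℝ E) (z : P) (w : Pᗮ) :
    P.orthogonalProjectionOnto ((z : E) + (w : E)) = z := by
  rw [map_add, P.orthogonalProjectionOnto_mem_subspace_eq_self,
    P.orthogonalProjectionOnto_apply_of_mem_orthogonal w.2, add_zero]

theorem orthogonalProjectionOnto_orthogonal_add (P : Submodule ℝ E) (z : P) (w : Pᗮ) :
    Pᗮ.orthogonalProjectionOnto ((z : E) + (w : E)) = w := by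
  rw [map_add, Pᗮ.orthogonalProjectionOnto_mem_subspace_eq_self,
    Pᗮ.orthogonalProjectionOnto_apply_of_mem_orthogonal
      (Submodule.le_orthogonal_orthogonal P z.2), zero_add]

theorem norm_le_norm_add_orthogonal (P : Submodule ℝ E) (z : P) (w : Pᗮ) :
    ‖z‖ ≤ ‖(z : E) + (w : E)‖ := by
  conv_lhs => rw [← orthogonalProjectionOnto_add_orthogonal P z w]
  exact P.norm_orthogonalProjectionOnto_apply_le _

theorem finrank_range_graphMap (P : Submodule ℝ E) (A : P →L[ℝ] Pᗮ) :
    finrank ℝ (graphMap P A).range = finrank ℝ P := by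
  refine LinearMap.finrank_range_of_inj (f := (graphMap P A : P →ₗ[ℝ] E)) fun v w h => ?_
  have := congrArg P.orthogonalProjectionOnto h
  change P.orthogonalProjectionOnto ((v : E) + (A v : E)) =
    P.orthogonalProjectionOnto ((w : E) + (A w : E)) at this
  simpa only [orthogonalProjectionOnto_add_orthogonal] using this

/-- `S` is near `x` the graph of a `C¹` function `f` over a ball of `P`, with derivative `G` and
second-order Taylor remainders controlled by `N`. -/
structure TaylorChart (S : Set E) (x : E) (P : Submodule ℝ E) (R : ℝ) (f : P → Pᗮ)
    (G : P → P →L[ℝ] Pᗮ) (N : P → ℝ≥0∞) : Prop where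
  pos : 0 < R
  continuousOn : ContinuousOn G (ball 0 R)
  hasFDerivAt : ∀ z ∈ ball (0 : P) R, HasFDerivAt f (G z) z
  taylor : ∀ z ∈ ball (0 : P) R, ∀ w, dist w z < R / 2 →
    ‖f w - f z - G z (w - z)‖ₑ ≤ N z * ‖w - z‖ₑ ^ 2
  exists_eq : ∀ y ∈ S ∩ ball x R, ∃ z ∈ ball (0 : P) R, graphPoint P x f z = y
  mem : ∀ z ∈ ball (0 : P) R, graphPoint P x f z ∈ ball x R → graphPoint P x f z ∈ S

theorem IsW2Manifold.exists_taylorChart (hm : 0 < m) {p : ℝ} (hp : (m : ℝ) < p) {S : Set E}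
    (hS : IsW2Manifold m p S) {x : E} (hx : x ∈ S) :
    ∃ P : Submodule ℝ E, finrank ℝ P = m ∧ ∃ R f G N, TaylorChart S x P R f G N ∧
      ∫⁻ z, N z ^ p ∂(Measure.hausdorffMeasure (m : ℝ)) < ⊤ := by
  obtain ⟨P, hP, R, hR, f, hW, hc, hS⟩ := hS x hx
  obtain ⟨G, N, hG, hN, hT⟩ := MemW2.exists_taylor (by omega) (by rwa [hP]) hR hW hc
  refine ⟨P, hP, R, f, G, N, ⟨hR, hG, fun z hz => (hT z hz).1, fun z hz => (hT z hz).2, ?_, ?_⟩, ?_⟩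
  · intro y hy
    rw [hS] at hy
    obtain ⟨_, ⟨⟨z, -, rfl⟩, hz⟩, rfl⟩ := hy
    refine ⟨z, ?_, rfl⟩
    rw [mem_ball_zero_iff] at hz ⊢
    exact (norm_le_norm_add_orthogonal P z (f z)).trans_lt hz
  · intro z hz hzx
    have : graphPoint P x f z ∈ S ∩ ball x R := by
      rw [hS]
      refine ⟨_, ⟨⟨z, ball_subset_ball (by linarith) hz, rfl⟩, ?_⟩, rfl⟩
      rw [graphPoint, mem_ball, dist_eq_norm, add_sub_cancel_left] at hzx
      rwa [mem_ball_zero_iff]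
    exact this.1
  · subst hP
    -- Both are Haar measures on `P`, hence proportional, so the L^p bound passes from one to the
    -- other.
    rw [Measure.isAddLeftInvariant_eq_smul (Measure.hausdorffMeasure (finrank ℝ P : ℝ))
      (volume : Measure P), ENNReal.smul_def, lintegral_smul_measure, smul_eq_mul]
    exact ENNReal.mul_lt_top ENNReal.coe_lt_top hN

namespace TaylorChart

variable {S : Set (EuclideanSpace ℝ (Fin n))} {x : EuclideanSpace ℝ (Fin n)}
  {P : Submodule ℝ (EuclideanSpace ℝ (Fin n))} {R : ℝ} {f : P → Pᗮ} {G : P → P →L[ℝ] Pᗮ}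
  {N : P → ℝ≥0∞}

theorem hasFDerivAt_graphPoint (h : TaylorChart S x P R f G N) {z : P} (hz : z ∈ ball 0 R) :
    HasFDerivAt (graphPoint P x f) (graphMap P (G z)) z :=
  (P.subtypeL.hasFDerivAt.add (Pᗮ.subtypeL.hasFDerivAt.comp z (h.hasFDerivAt z hz))).const_add x

/-- On one side, a defining function of the graph vanishes on `S` near the point, so its derivative
kills the cone. On the other, the derivative of the parametrisation sends all of `P` into the cone.
-/
theorem coe_tangentCone (h : TaylorChart S x P R f G N) {z : P} (hz : z ∈ ball 0 R)
    (hzx : graphPoint P x f z ∈ ball x R) :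
    tangentConeAt ℝ S (graphPoint P x f z) = range (graphMap P (G z)) := by
  have hF := h.hasFDerivAt_graphPoint hz
  refine Subset.antisymm (fun v hv => ?_) ?_
  · let Ψ : E → Pᗮ := fun y => Pᗮ.orthogonalProjectionOnto (y - x) -
      f (P.orthogonalProjectionOnto (y - x))
    have hπ : P.orthogonalProjectionOnto (graphPoint P x f z - x) = z := by
      rw [graphPoint, add_sub_cancel_left, orthogonalProjectionOnto_add_orthogonal]
    have hΨ : HasFDerivAt Ψ (Pᗮ.orthogonalProjectionOnto -
        G z ∘L P.orthogonalProjectionOnto) (graphPoint P x f z) := by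
      have h1 : ∀ Q : Submodule ℝ E, HasFDerivAt (fun y => Q.orthogonalProjectionOnto (y - x))
          Q.orthogonalProjectionOnto (graphPoint P x f z) := fun Q =>
        (Q.orthogonalProjectionOnto.hasFDerivAt.comp _ ((hasFDerivAt_id _).sub_const x))
      refine (h1 Pᗮ).sub (HasFDerivAt.comp (g := f) _ ?_ (h1 P))
      rw [hπ]
      exact h.hasFDerivAt z hz
    have hΨ0 : Ψ '' (S ∩ ball x R) ⊆ {0} := by
      rintro _ ⟨y, hy, rfl⟩
      obtain ⟨w, -, rfl⟩ := h.exists_eq y hy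
      simp only [Ψ, graphPoint, add_sub_cancel_left, orthogonalProjectionOnto_add_orthogonal,
        orthogonalProjectionOnto_orthogonal_add, sub_self, mem_singleton_iff]
    rw [← tangentConeAt_inter_nhds (isOpen_ball.mem_nhds hzx)] at hv
    have h2 := tangentConeAt_mono hΨ0 (hΨ.hasFDerivWithinAt.mapsTo_tangent_cone hv)
    have h3 := tangentConeAt_subset_zero (𝕜 := ℝ) (s := {(0 : Pᗮ)}) (x := Ψ (graphPoint P x f z))
      (fun hacc => (finite_singleton (0 : Pᗮ)).not_infinite (Set.Infinite.of_accPt hacc)) h2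
    have h4 : Pᗮ.orthogonalProjectionOnto v = G z (P.orthogonalProjectionOnto v) :=
      sub_eq_zero.1 h3
    refine ⟨P.orthogonalProjectionOnto v, ?_⟩
    rw [graphMap_apply, ← h4]
    exact P.starProjection_add_starProjection_orthogonal v
  · rintro _ ⟨v, rfl⟩
    have hs : ball (0 : P) R ∩ graphPoint P x f ⁻¹' ball x R ∈ 𝓝 z :=
      inter_mem (isOpen_ball.mem_nhds hz) (hF.continuousAt (isOpen_ball.mem_nhds hzx))
    have hv : v ∈ tangentConeAt ℝ (ball (0 : P) R ∩ graphPoint P x f ⁻¹' ball x R) z := by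
      rw [tangentConeAt_of_mem_nhds hs]; trivial
    have h1 := hF.hasFDerivWithinAt.mapsTo_tangent_cone hv
    refine tangentConeAt_mono ?_ h1
    rintro _ ⟨w, hw, rfl⟩
    exact h.mem w hw.1 hw.2

theorem tangentPlane_eq (h : TaylorChart S x P R f G N) {z : P} (hz : z ∈ ball 0 R)
    (hzx : graphPoint P x f z ∈ ball x R) :
    tangentPlane S (graphPoint P x f z) = (graphMap P (G z)).range := by
  rw [tangentPlane, h.coe_tangentCone hz hzx]
  exact Submodule.span_eq (graphMap P (G z)).range

theorem enorm_sub_le_graphPoint (z w : P) :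
    ‖w - z‖ₑ ≤ edist (graphPoint P x f w) (graphPoint P x f z) := by
  rw [edist_eq_enorm_sub, ← ofReal_norm, ← ofReal_norm]
  apply ENNReal.ofReal_le_ofReal
  have : graphPoint P x f w - graphPoint P x f z = ((w - z : P) : E) + ((f w - f z : Pᗮ) : E) := by
    simp only [graphPoint, Submodule.coe_sub]
    abel
  rw [this]
  exact norm_le_norm_add_orthogonal P _ _

/-- The vector `t` is the linearised displacement, so the error is exactly the Taylor remainder of
`f`. Parameters are no further apart than the graph points, by orthogonal projection. This one
estimate feeds both curvatures. -/
theorem exists_mem_tangentPlane (h : TaylorChart S x P R f G N) {z : P} (hz : z ∈ ball 0 R)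
    (hzx : graphPoint P x f z ∈ ball x (R / 2)) {y : E} (hy : y ∈ S)
    (hd : dist y (graphPoint P x f z) < R / 2) :
    ∃ t ∈ tangentPlane S (graphPoint P x f z), ‖y - graphPoint P x f z - t‖ₑ ≤
      N z * edist y (graphPoint P x f z) ^ 2 := by
  have hR := h.pos
  have hyx : y ∈ ball x R := by
    rw [mem_ball] at hzx ⊢
    have := dist_triangle y (graphPoint P x f z) x
    linarith
  obtain ⟨w, hw, rfl⟩ := h.exists_eq y ⟨hy, hyx⟩
  have hle := enorm_sub_le_graphPoint (x := x) (f := f) z w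
  have hwz : dist w z < R / 2 := by
    rw [← edist_eq_enorm_sub, edist_dist, edist_dist,
      ENNReal.ofReal_le_ofReal_iff dist_nonneg] at hle
    exact hle.trans_lt hd
  refine ⟨graphMap P (G z) (w - z), ?_, ?_⟩
  · rw [h.tangentPlane_eq hz (ball_subset_ball (by linarith) hzx)]
    exact LinearMap.mem_range_self _ _
  · have : graphPoint P x f w - graphPoint P x f z - graphMap P (G z) (w - z) =
        ((f w - f z - G z (w - z) : Pᗮ) : E) := by
      simp only [graphPoint, graphMap_apply, Submodule.coe_sub]
      abel
    rw [this]
    refine (h.taylor z hz w hwz).trans ?_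
    gcongr

end TaylorChart

end Chart

/-! ### Pointwise curvature bounds and their local integrals. -/

section Curvature

set_option maxSynthPendingDepth 3

open Module Filter Topology

variable {n m : ℕ} {S : Set (EuclideanSpace ℝ (Fin n))} {x : EuclideanSpace ℝ (Fin n)}
  {P : Submodule ℝ (EuclideanSpace ℝ (Fin n))} {R : ℝ} {f : P → Pᗮ} {G : P → P →L[ℝ] Pᗮ}
  {N : P → ℝ≥0∞}

theorem inv_tangentPointRadius (x y : EuclideanSpace ℝ (Fin n))
    (H : Submodule ℝ (EuclideanSpace ℝ (Fin n))) : (tangentPointRadius x y H)⁻¹ =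
      2 * infEDist y (AffineSubspace.mk' x H : Set (EuclideanSpace ℝ (Fin n))) / edist y x ^ 2 := by
  rw [tangentPointRadius]
  split_ifs with h
  · rw [infEDist_zero_of_mem h]
    simp
  · have hne : y ≠ x := by
      rintro rfl
      exact h (AffineSubspace.self_mem_mk' _ _)
    rw [ENNReal.inv_div (Or.inr (by finiteness)) (Or.inr (by simpa using hne))]

theorem add_mem_mk' (x : EuclideanSpace ℝ (Fin n)) {H : Submodule ℝ (EuclideanSpace ℝ (Fin n))}
    {t : EuclideanSpace ℝ (Fin n)} (ht : t ∈ H) : x + t ∈ AffineSubspace.mk' x H := by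
  rw [AffineSubspace.mem_mk', vsub_eq_sub, add_sub_cancel_left]
  exact ht

theorem inv_tangentPointRadius_le_of_mem (x y : EuclideanSpace ℝ (Fin n))
    {H : Submodule ℝ (EuclideanSpace ℝ (Fin n))} {t : EuclideanSpace ℝ (Fin n)} (ht : t ∈ H)
    {c : ℝ≥0∞} (hc : ‖y - x - t‖ₑ ≤ c * edist y x ^ 2) : (tangentPointRadius x y H)⁻¹ ≤ 2 * c := by
  rw [inv_tangentPointRadius]
  refine ENNReal.div_le_of_le_mul ?_
  rw [mul_assoc]
  gcongr
  refine (infEDist_le_edist_of_mem (add_mem_mk' x ht)).trans ?_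
  rwa [edist_eq_enorm_sub, ← sub_sub]

/-- The plane `F z + graph (G z)` varies lower semicontinuously, in the sense of the distance to a
fixed point. -/
theorem TaylorChart.lowerSemicontinuousOn_infEDist (h : TaylorChart S x P R f G N)
    (w : EuclideanSpace ℝ (Fin n)) : LowerSemicontinuousOn (fun y => infEDist w
      (AffineSubspace.mk' y (tangentPlane S y) : Set (EuclideanSpace ℝ (Fin n))))
      (S ∩ ball x R) := by
  intro y hy r hr
  set ζ := fun y : EuclideanSpace ℝ (Fin n) => P.orthogonalProjectionOnto (y - x) with hζ
  have hζc : Continuous ζ := by fun_prop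
  have hpl : ∀ y ∈ S ∩ ball x R, ζ y ∈ ball (0 : P) R ∧
      tangentPlane S y = (graphMap P (G (ζ y))).range := by
    intro y hy
    obtain ⟨z, hz, rfl⟩ := h.exists_eq y hy
    have : ζ (graphPoint P x f z) = z := by
      simp only [hζ, graphPoint, add_sub_cancel_left, orthogonalProjectionOnto_add_orthogonal]
    rw [this]
    exact ⟨hz, h.tangentPlane_eq hz hy.2⟩
  obtain ⟨hyR, hyT⟩ := hpl y hy
  obtain ⟨r', hr1, hr2⟩ := exists_between hr
  have hr't : r' ≠ ⊤ := hr2.ne_top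
  set γ := fun y' => ‖G (ζ y') - G (ζ y)‖ₑ with hγ
  have hGc : ContinuousAt (fun y' => G (ζ y')) y :=
    (h.continuousOn.continuousAt (isOpen_ball.mem_nhds hyR)).comp' hζc.continuousAt
  have hγ0 : Tendsto γ (𝓝 y) (𝓝 0) := by
    have := (hGc.sub (continuousAt_const (y := G (ζ y)))).enorm.tendsto
    simpa using this
  have he0 : Tendsto (fun y' => edist y' y) (𝓝 y) (𝓝 0) := by
    have : Continuous fun y' => edist y' y := by fun_prop
    simpa using this.tendsto y
  have hw0 : Tendsto (fun y' => edist w y') (𝓝 y) (𝓝 (edist w y)) := by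
    have : Continuous fun y' => edist w y' := by fun_prop
    exact this.tendsto y
  have hlim : Tendsto (fun y' => r' + edist y' y + γ y' * (r' + edist w y')) (𝓝 y) (𝓝 r') := by
    have h1 := ENNReal.Tendsto.mul hγ0 (Or.inr (by finiteness))
      (tendsto_const_nhds (x := r').add hw0) (Or.inr ENNReal.zero_ne_top)
    have h2 := ((tendsto_const_nhds (x := r')).add he0).add h1
    simpa using h2
  filter_upwards [nhdsWithin_le_nhds (hlim.eventually (gt_mem_nhds hr2)), self_mem_nhdsWithin]
    with y' hy' hyS
  by_contra hcon
  have hlt : infEDist w (AffineSubspace.mk' y' (tangentPlane S y') :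
      Set (EuclideanSpace ℝ (Fin n))) < r' := (not_lt.1 hcon).trans_lt hr1
  obtain ⟨q', hq', hlt⟩ := infEDist_lt_iff.1 hlt
  have hq'' : q' - y' ∈ tangentPlane S y' := hq'
  rw [(hpl y' hyS).2] at hq''
  obtain ⟨v, hv⟩ := hq''
  have hv : graphMap P (G (ζ y')) v = q' - y' := hv
  -- The near point `q'` of the plane at `y'` is transported to the plane at `y` with the same
  -- parameter `v`. The error is |y' - y| plus the change of `G` times |v|, and |v| is controlled by
  -- distances to `w`.
  have hmem : graphMap P (G (ζ y)) v ∈ tangentPlane S y := by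
    rw [hyT]; exact LinearMap.mem_range_self _ _
  have hvn : ‖v‖ₑ ≤ edist w q' + edist w y' := by
    have h1 : ‖v‖ₑ ≤ ‖q' - y'‖ₑ := by
      rw [← hv, ← ofReal_norm, ← ofReal_norm]
      exact ENNReal.ofReal_le_ofReal (norm_le_norm_add_orthogonal P v _)
    rw [← edist_eq_enorm_sub] at h1
    exact h1.trans (edist_triangle_left _ _ _)
  have hdiff : q' - (y + graphMap P (G (ζ y)) v) =
      (y' - y) + (((G (ζ y') - G (ζ y)) v : Pᗮ) : EuclideanSpace ℝ (Fin n)) := by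
    have : q' = y' + graphMap P (G (ζ y')) v := by rw [hv]; abel
    rw [this, graphMap_apply, graphMap_apply, sub_apply, Submodule.coe_sub]
    abel
  refine absurd (infEDist_le_edist_of_mem (x := w) (add_mem_mk' y hmem)) (not_le.2 ?_)
  calc edist w (y + graphMap P (G (ζ y)) v)
      ≤ edist w q' + edist q' (y + graphMap P (G (ζ y)) v) := edist_triangle _ _ _
    _ ≤ edist w q' + (edist y' y + γ y' * (edist w q' + edist w y')) := by
        gcongr
        rw [edist_eq_enorm_sub, hdiff, edist_eq_enorm_sub]
        refine (enorm_add_le _ _).trans ?_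
        gcongr
        refine le_trans ?_ (mul_le_mul_right hvn _)
        exact (G (ζ y') - G (ζ y)).le_opENorm v
    _ ≤ r' + (edist y' y + γ y' * (r' + edist w y')) := by gcongr
    _ < _ := by rwa [← add_assoc]

theorem TaylorChart.lowerSemicontinuousOn_globalTangentPoint (h : TaylorChart S x P R f G N) :
    LowerSemicontinuousOn (globalTangentPoint S (tangentPlane S)) (S ∩ ball x R) := by
  refine lowerSemicontinuousOn_biSup fun w _ y hy c hc => ?_
  simp only [inv_tangentPointRadius] at hc ⊢
  have hct : c ≠ ⊤ := hc.ne_top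
  rw [gt_iff_lt, ENNReal.lt_div_iff_mul_lt (Or.inr hct) (Or.inl (by finiteness))] at hc
  obtain ⟨r, hr1, hr2⟩ := exists_between hc
  have h1 : r / 2 < infEDist w
      (AffineSubspace.mk' y (tangentPlane S y) : Set (EuclideanSpace ℝ (Fin n))) := by
    rwa [ENNReal.div_lt_iff (Or.inl (by simp)) (Or.inl (by simp)), mul_comm]
  have h2 : Tendsto (fun y' => c * edist w y' ^ 2) (𝓝 y) (𝓝 (c * edist w y ^ 2)) := by
    have h3 : Tendsto (fun y' => edist w y') (𝓝 y) (𝓝 (edist w y)) := by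
      have : Continuous fun y' => edist w y' := by fun_prop
      exact this.tendsto y
    exact ENNReal.Tendsto.const_mul (ENNReal.Tendsto.pow h3) (Or.inr hct)
  filter_upwards [h.lowerSemicontinuousOn_infEDist w y hy _ h1,
    nhdsWithin_le_nhds (h2.eventually (gt_mem_nhds hr1))] with y' h3 h4
  rw [gt_iff_lt, ENNReal.div_lt_iff (Or.inl (by simp)) (Or.inl (by simp)), mul_comm] at h3
  rw [gt_iff_lt, ENNReal.lt_div_iff_mul_lt (Or.inr hct) (Or.inl (by finiteness))]
  exact h4.trans h3

theorem TaylorChart.globalTangentPoint_le (h : TaylorChart S x P R f G N) {z : P}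
    (hz : z ∈ ball 0 R) (hzx : graphPoint P x f z ∈ ball x (R / 2)) :
    globalTangentPoint S (tangentPlane S) (graphPoint P x f z) ≤
      2 * ENNReal.ofReal (2 / R) + 2 * N z := by
  have hR := h.pos
  refine iSup₂_le fun y hy => ?_
  rcases lt_or_ge (dist y (graphPoint P x f z)) (R / 2) with hlt | hge
  · obtain ⟨t, ht, hle⟩ := h.exists_mem_tangentPlane hz hzx hy hlt
    exact (inv_tangentPointRadius_le_of_mem _ _ ht hle).trans le_add_self
  -- For far points the trivial bound dist(y, x + H) ≤ |y - x| suffices, and |y - x| ≥ R/2 turns it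
  -- into a quadratic one.
  · refine (inv_tangentPointRadius_le_of_mem _ _ (Submodule.zero_mem _) (t := 0)
      (c := ENNReal.ofReal (2 / R)) ?_).trans le_self_add
    rw [sub_zero, ← edist_eq_enorm_sub, edist_dist, ← ENNReal.ofReal_pow dist_nonneg,
      ← ENNReal.ofReal_mul (by positivity)]
    apply ENNReal.ofReal_le_ofReal
    rw [sq, ← mul_assoc]
    refine le_mul_of_one_le_left dist_nonneg ?_
    calc 1 = 2 / R * (R / 2) := by field_simp
      _ ≤ _ := by gcongr

/-- The constant in the estimate of the Menger curvature by the distances to a plane. -/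
noncomputable def mengerConst (m : ℕ) : ℝ≥0∞ :=
  volume (ball (0 : EuclideanSpace ℝ (Fin (m + 1))) (1 / 2)) * ((m + 1) ^ (m + 1) * 2 ^ (m + 1))

theorem mengerConst_ne_top (m : ℕ) : mengerConst m ≠ ⊤ := by
  have : volume (ball (0 : EuclideanSpace ℝ (Fin (m + 1))) (1 / 2)) ≠ ⊤ := measure_ball_lt_top.ne
  rw [mengerConst]
  finiteness

theorem mengerConst_ne_zero (m : ℕ) : mengerConst m ≠ 0 := by
  have : volume (ball (0 : EuclideanSpace ℝ (Fin (m + 1))) (1 / 2)) ≠ 0 :=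
    (measure_ball_pos _ _ (by norm_num)).ne'
  rw [mengerConst]
  exact mul_ne_zero this (by simp)

/-- A slab of half-width c d² gives volume of order c d² d^m, which the denominator d^(m+2) cancels
exactly. -/
theorem mengerK_le {y : Fin (m + 2) → EuclideanSpace ℝ (Fin n)}
    {T : Submodule ℝ (EuclideanSpace ℝ (Fin n))} (hT : finrank ℝ T ≤ m) {c : ℝ} (hc : 0 ≤ c)
    (h : ∀ i, ∃ t ∈ T, ‖y i - y 0 - t‖ ≤ c * (ediam (range y)).toReal ^ 2) :
    mengerK m y ≤ mengerConst m * ENNReal.ofReal c := by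
  have hDt : ediam (range y) ≠ ⊤ := ediam_range_ne_top y
  set d := (ediam (range y)).toReal with hd
  have hD : ediam (range y) = ENNReal.ofReal d := (ENNReal.ofReal_toReal hDt).symm
  have hd0 : 0 ≤ d := ENNReal.toReal_nonneg
  have hdi : ∀ i, ‖y i - y 0‖ ≤ d := by
    intro i
    rw [← dist_eq_norm, dist_edist]
    exact ENNReal.toReal_mono hDt (edist_le_ediam_of_mem (mem_range_self i) (mem_range_self 0))
  refine ENNReal.div_le_of_le_mul ?_
  rw [hausdorff_apply, mengerConst, hD, mul_assoc, mul_assoc]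
  refine mul_le_mul_right ?_ _
  refine (hausdorffMeasure_convexHull_le hT hdi h).trans (le_of_eq ?_)
  rw [mul_assoc]
  congr 1
  rw [ENNReal.ofReal_mul (by norm_num), ENNReal.ofReal_mul hc, ENNReal.ofReal_mul (by norm_num),
    ENNReal.ofReal_pow hd0, ENNReal.ofReal_ofNat, mul_pow]
  ring

theorem TaylorChart.globalMenger_le (hP : finrank ℝ P = m) (h : TaylorChart S x P R f G N) {z : P}
    (hz : z ∈ ball 0 R) (hzx : graphPoint P x f z ∈ ball x (R / 2)) :
    globalMenger m S (graphPoint P x f z) ≤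
      mengerConst m * ENNReal.ofReal (2 / R) + mengerConst m * N z := by
  have hR := h.pos
  set y₀ := graphPoint P x f z with hy₀
  have hyS : y₀ ∈ S := h.mem z hz (ball_subset_ball (by linarith) hzx)
  rcases eq_or_ne (N z) ⊤ with hN | hN
  · rw [hN, ENNReal.mul_top (mengerConst_ne_zero m), add_top]
    exact le_top
  refine iSup₂_le fun y hy => ?_
  set Y : Fin (m + 2) → EuclideanSpace ℝ (Fin n) := Fin.cons y₀ y with hY
  have hY0 : Y 0 = y₀ := rfl
  have hYS : ∀ i, Y i ∈ S := fun i => by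
    refine Fin.cases hyS (fun i => ?_) i
    exact hy i
  have hDt : ediam (range Y) ≠ ⊤ := ediam_range_ne_top Y
  have hd : ∀ i, dist (Y i) (Y 0) ≤ (ediam (range Y)).toReal := fun i => by
    rw [dist_edist]
    exact ENNReal.toReal_mono hDt (edist_le_ediam_of_mem (mem_range_self i) (mem_range_self 0))
  set d := (ediam (range Y)).toReal with hdd
  have hd0 : 0 ≤ d := ENNReal.toReal_nonneg
  have hT : finrank ℝ (tangentPlane S y₀) ≤ m := by
    rw [h.tangentPlane_eq hz (ball_subset_ball (by linarith) hzx), finrank_range_graphMap, hP]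
  rcases lt_or_ge d (R / 2) with hlt | hge
  · refine le_trans (mengerK_le hT (c := (N z).toReal) ENNReal.toReal_nonneg fun i => ?_)
      (le_trans (by rw [ENNReal.ofReal_toReal hN]) le_add_self)
    obtain ⟨t, ht, hle⟩ := h.exists_mem_tangentPlane hz hzx (hYS i) ((hd i).trans_lt hlt)
    refine ⟨t, ht, ?_⟩
    have h1 := ENNReal.toReal_mono (by finiteness) hle
    rw [toReal_enorm, ENNReal.toReal_mul, ENNReal.toReal_pow, ← dist_edist] at h1
    refine h1.trans ?_
    gcongr
    exact hd i
  -- Large simplices need no tangency: d ≤ (2/R) d² once d ≥ R/2.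
  · refine le_trans (mengerK_le hT (c := 2 / R) (by positivity) fun i => ?_) le_self_add
    refine ⟨0, Submodule.zero_mem _, ?_⟩
    rw [sub_zero, ← dist_eq_norm]
    refine (hd i).trans ?_
    rw [sq, ← mul_assoc]
    refine le_mul_of_one_le_left hd0 ?_
    calc 1 = 2 / R * (R / 2) := by field_simp
      _ ≤ _ := by gcongr

/-- Near the centre of a chart, integrals over `S` are controlled by integrals over the domain of
the parametrisation. -/
theorem TaylorChart.exists_lintegral_lt_top (hP : finrank ℝ P = m) (h : TaylorChart S x P R f G N)
    {p : ℝ} (hp : 1 ≤ p) (hN : ∫⁻ z, N z ^ p ∂(Measure.hausdorffMeasure (m : ℝ)) < ⊤) :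
    ∃ δ, 0 < δ ∧ δ ≤ R ∧ ∀ (u : EuclideanSpace ℝ (Fin n) → ℝ≥0∞) (a b : ℝ≥0∞), a ≠ ⊤ → b ≠ ⊤ →
      (∀ z ∈ ball (0 : P) R, graphPoint P x f z ∈ ball x (R / 2) →
        u (graphPoint P x f z) ≤ a + b * N z) →
      ∫⁻ y in S ∩ ball x δ, u y ^ p ∂(Measure.hausdorffMeasure (m : ℝ)) < ⊤ := by
  have hR := h.pos
  have h0 : (0 : P) ∈ ball (0 : P) R := mem_ball_self hR
  have hnhds : ball (0 : P) R ∈ 𝓝 (0 : P) := isOpen_ball.mem_nhds h0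
  have hstrict : HasStrictFDerivAt f (G 0) 0 :=
    hasStrictFDerivAt_of_hasFDerivAt_of_continuousAt
      (by filter_upwards [hnhds] with z hz using h.hasFDerivAt z hz)
      (h.continuousOn.continuousAt hnhds)
  have hstrict' : HasStrictFDerivAt (graphPoint P x f) (graphMap P (G 0)) 0 :=
    (P.subtypeL.hasStrictFDerivAt.add
      (Pᗮ.subtypeL.hasStrictFDerivAt.comp (0 : P) hstrict)).const_add x
  obtain ⟨K, s, hs, hK⟩ := hstrict'.exists_lipschitzOnWith
  obtain ⟨δ₀, hδ₀, hball⟩ := Metric.mem_nhds_iff.1 hs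
  -- `δ₀` gives the Lipschitz bound; R/2 keeps the points where the hypothesis on `u` applies.
  set δ := min δ₀ (R / 2) with hδ
  have hδpos : 0 < δ := lt_min hδ₀ (by positivity)
  have hδR : δ ≤ R / 2 := min_le_right _ _
  refine ⟨δ, hδpos, by linarith, fun u a b ha hb hu => ?_⟩
  set F := graphPoint P x f with hF
  set μP : Measure P := Measure.hausdorffMeasure (m : ℝ) with hμP
  set B := ball (0 : P) δ ∩ F ⁻¹' ball x δ with hB
  have hFc : ContinuousOn F (ball (0 : P) δ) := (hK.mono
    ((ball_subset_ball (min_le_left _ _)).trans hball)).continuousOn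
  have hBo : IsOpen B := hFc.isOpen_inter_preimage isOpen_ball isOpen_ball
  have hKB : LipschitzOnWith K F B :=
    hK.mono (inter_subset_left.trans ((ball_subset_ball (min_le_left _ _)).trans hball))
  have hFm : AEMeasurable F (μP.restrict B) := hKB.continuousOn.aemeasurable hBo.measurableSet
  have hsub : S ∩ ball x δ ⊆ F '' B := by
    intro y hy
    obtain ⟨z, hz, rfl⟩ := h.exists_eq y ⟨hy.1, ball_subset_ball (by linarith) hy.2⟩
    refine ⟨z, ⟨?_, hy.2⟩, rfl⟩
    have h1 := hy.2
    rw [graphPoint, mem_ball, dist_eq_norm, add_sub_cancel_left] at h1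
    rw [mem_ball_zero_iff]
    exact (norm_le_norm_add_orthogonal P z (f z)).trans_lt h1
  -- No area formula is needed: the Lipschitz covering of `S ∩ ball x δ` by `F '' B` dominates the
  -- measure by a multiple of a pushforward.
  have hle : (Measure.hausdorffMeasure (m : ℝ)).restrict (S ∩ ball x δ) ≤
      ((K : ℝ≥0∞) ^ m) • Measure.map F (μP.restrict B) := by
    refine Measure.le_iff.2 fun A hA => ?_
    rw [Measure.restrict_apply hA, Measure.smul_apply, smul_eq_mul,
      Measure.map_apply_of_aemeasurable hFm hA]
    have h1 : A ∩ (S ∩ ball x δ) ⊆ F '' (F ⁻¹' A ∩ B) := by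
      rintro y ⟨hyA, hy⟩
      obtain ⟨z, hz, rfl⟩ := hsub hy
      exact ⟨z, ⟨hyA, hz⟩, rfl⟩
    refine (measure_mono h1).trans (((hKB.mono inter_subset_right).hausdorffMeasure_image_le
      (Nat.cast_nonneg m)).trans ?_)
    rw [ENNReal.rpow_natCast]
    exact mul_le_mul_right (Measure.le_restrict_apply _ _) _
  have hBfin : μP B < ⊤ := by
    refine (measure_mono inter_subset_left).trans_lt ?_
    rw [hμP, ← hP]
    exact measure_ball_lt_top
  calc ∫⁻ y in S ∩ ball x δ, u y ^ p ∂(Measure.hausdorffMeasure (m : ℝ))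
      ≤ ∫⁻ y, u y ^ p ∂(((K : ℝ≥0∞) ^ m) • Measure.map F (μP.restrict B)) :=
        lintegral_mono' hle le_rfl
    -- This direction of the change of variables holds without measurability of `u`.
    _ ≤ (K : ℝ≥0∞) ^ m * ∫⁻ z in B, u (F z) ^ p ∂μP := by
        rw [lintegral_smul_measure, smul_eq_mul]
        gcongr
        exact lintegral_map_le _ _
    _ ≤ (K : ℝ≥0∞) ^ m * ∫⁻ z in B, 2 ^ (p - 1) * (a ^ p + b ^ p * N z ^ p) ∂μP := by
        gcongr (K : ℝ≥0∞) ^ m * ?_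
        refine setLIntegral_mono' hBo.measurableSet fun z hz => ?_
        have hz1 : z ∈ ball (0 : P) R := ball_subset_ball (by linarith) hz.1
        have hz2 : F z ∈ ball x (R / 2) := ball_subset_ball hδR hz.2
        calc u (F z) ^ p ≤ (a + b * N z) ^ p := by
              gcongr
              exact hu z hz1 hz2
          _ ≤ 2 ^ (p - 1) * (a ^ p + (b * N z) ^ p) :=
              ENNReal.rpow_add_le_mul_rpow_add_rpow _ _ hp
          _ = _ := by rw [ENNReal.mul_rpow_of_nonneg _ _ (by linarith)]
    _ = (K : ℝ≥0∞) ^ m * (2 ^ (p - 1) * (a ^ p * μP B + b ^ p * ∫⁻ z in B, N z ^ p ∂μP)) := by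
        have hap : a ^ p ≠ ⊤ := ENNReal.rpow_ne_top_of_nonneg (by linarith) ha
        have hbp : b ^ p ≠ ⊤ := ENNReal.rpow_ne_top_of_nonneg (by linarith) hb
        rw [lintegral_const_mul' _ _ (ENNReal.rpow_ne_top_of_nonneg (by linarith) (by simp)),
          lintegral_add_left measurable_const, lintegral_const_mul' _ _ hbp, setLIntegral_const]
    _ < ⊤ := by
        have h1 : ∫⁻ z in B, N z ^ p ∂μP < ⊤ := (setLIntegral_le_lintegral _ _).trans_lt hN
        have hap : a ^ p < ⊤ := ENNReal.rpow_lt_top_of_nonneg (by linarith) ha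
        have hbp : b ^ p < ⊤ := ENNReal.rpow_lt_top_of_nonneg (by linarith) hb
        have h2p : (2 : ℝ≥0∞) ^ (p - 1) < ⊤ :=
          ENNReal.rpow_lt_top_of_nonneg (by linarith) (by simp)
        refine ENNReal.mul_lt_top (by finiteness) (ENNReal.mul_lt_top h2p ?_)
        exact ENNReal.add_lt_top.2 ⟨ENNReal.mul_lt_top hap hBfin, ENNReal.mul_lt_top hbp h1⟩

end Curvature

/-! ### From local integrability to the compact set. -/

section Global

open Module Filter Topology

/-- Compactness induction: the property passes to subsets and to unions, the latter because
restriction to a union is dominated by the sum of the restrictions. -/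
theorem memLp_restrict_of_isCompact {X : Type*} [TopologicalSpace X] [MeasurableSpace X]
    {μ : Measure X} {S : Set X} (hS : IsCompact S) {u : X → ℝ≥0∞} {q : ℝ≥0∞} (hq0 : q ≠ 0)
    (hqt : q ≠ ⊤) (hloc : ∀ x ∈ S, ∃ t ∈ 𝓝[S] x, MemLp u q (μ.restrict t)) :
    MemLp u q (μ.restrict S) := by
  refine hS.induction_on (p := fun s => MemLp u q (μ.restrict s)) ?_ ?_ ?_ hloc
  · rw [Measure.restrict_empty]
    exact memLp_measure_zero
  · exact fun s t hst ht => ht.mono_measure (Measure.restrict_mono hst le_rfl)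
  · intro s t hs ht
    refine MemLp.mono_measure (Measure.restrict_union_le s t) ⟨hs.1.add_measure ht.1, ?_⟩
    have h1 := hs.2
    have h2 := ht.2
    rw [eLpNorm_lt_top_iff_lintegral_rpow_enorm_lt_top hq0 hqt] at h1 h2 ⊢
    rw [lintegral_add_measure]
    exact ENNReal.add_lt_top.2 ⟨h1, h2⟩

theorem memLp_hausdorff_restrict {n m : ℕ} {A : Set (EuclideanSpace ℝ (Fin n))}
    {u : EuclideanSpace ℝ (Fin n) → ℝ≥0∞} {p : ℝ} (hp : 0 < p)
    (hum : AEMeasurable u ((Measure.hausdorffMeasure (m : ℝ)).restrict A))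
    (hu : ∫⁻ y in A, u y ^ p ∂(Measure.hausdorffMeasure (m : ℝ)) < ⊤) :
    MemLp u (ENNReal.ofReal p) ((hausdorff m).restrict A) := by
  rw [hausdorff, Measure.restrict_smul]
  refine MemLp.smul_measure ⟨hum.aestronglyMeasurable, ?_⟩ measure_ball_lt_top.ne
  rw [eLpNorm_lt_top_iff_lintegral_rpow_enorm_lt_top (by simpa using hp) ENNReal.ofReal_ne_top,
    ENNReal.toReal_ofReal hp.le]
  exact hu

theorem LowerSemicontinuousOn.aemeasurable_restrict {X : Type*} [TopologicalSpace X]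
    [MeasurableSpace X] [OpensMeasurableSpace X] {A : Set X} (hA : MeasurableSet A) {u : X → ℝ≥0∞}
    (hu : LowerSemicontinuousOn u A) (μ : Measure X) : AEMeasurable u (μ.restrict A) :=
  aemeasurable_restrict_of_measurable_subtype hA
    (lowerSemicontinuous_restrict_iff.2 hu).measurable

end Global

theorem mainTheorem4 (n m : ℕ) (hm : 0 < m) (p : ℝ) (hp : (m : ℝ) < p)
    (S : Set (EuclideanSpace ℝ (Fin n))) (hS : IsCompact S) (hW : IsW2Manifold m p S) :
    MemLp (globalMenger m S) (ENNReal.ofReal p) ((hausdorff m).restrict S) ∧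
    (∀ x ∈ S, (tangentPlane S x : Set (EuclideanSpace ℝ (Fin n))) = tangentConeAt ℝ S x ∧
      Module.finrank ℝ (tangentPlane S x) = m) ∧
    MemLp (globalTangentPoint S (tangentPlane S)) (ENNReal.ofReal p)
      ((hausdorff m).restrict S) := by
  have hm1 : (1 : ℝ) ≤ m := by exact_mod_cast hm
  have hp1 : 1 ≤ p := by linarith
  have hp0 : 0 < p := by linarith
  have hq0 : ENNReal.ofReal p ≠ 0 := by simpa using hp0
  refine ⟨memLp_restrict_of_isCompact hS hq0 ENNReal.ofReal_ne_top fun x hx => ?_, fun x hx => ?_,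
    memLp_restrict_of_isCompact hS hq0 ENNReal.ofReal_ne_top fun x hx => ?_⟩
  · obtain ⟨P, hP, R, f, G, N, h, hN⟩ := hW.exists_taylorChart hm hp hx
    obtain ⟨δ, hδ, hδR, hint⟩ := h.exists_lintegral_lt_top hP hp1 hN
    refine ⟨S ∩ ball x δ, inter_mem_nhdsWithin S (ball_mem_nhds x hδ), ?_⟩
    refine memLp_hausdorff_restrict hp0 (measurable_globalMenger S).aemeasurable
      (hint _ _ _ ?_ (mengerConst_ne_top m) fun z hz hzx => h.globalMenger_le hP hz hzx)
    exact ENNReal.mul_ne_top (mengerConst_ne_top m) ENNReal.ofReal_ne_top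
  · obtain ⟨P, hP, R, f, G, N, h, -⟩ := hW.exists_taylorChart hm hp hx
    obtain ⟨z, hz, hzx⟩ := h.exists_eq x ⟨hx, mem_ball_self h.pos⟩
    have hzb : graphPoint P x f z ∈ ball x R := by rw [hzx]; exact mem_ball_self h.pos
    have h1 := h.tangentPlane_eq hz hzb
    have h2 := h.coe_tangentCone hz hzb
    rw [hzx] at h1 h2
    rw [h1, h2, finrank_range_graphMap, hP]
    exact ⟨rfl, rfl⟩
  · obtain ⟨P, hP, R, f, G, N, h, hN⟩ := hW.exists_taylorChart hm hp hx
    obtain ⟨δ, hδ, hδR, hint⟩ := h.exists_lintegral_lt_top hP hp1 hN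
    refine ⟨S ∩ ball x δ, inter_mem_nhdsWithin S (ball_mem_nhds x hδ), ?_⟩
    refine memLp_hausdorff_restrict hp0
      (LowerSemicontinuousOn.aemeasurable_restrict (hS.measurableSet.inter measurableSet_ball)
        (h.lowerSemicontinuousOn_globalTangentPoint.mono
          (inter_subset_inter_right S (ball_subset_ball hδR))) _)
      (hint _ _ _ ?_ ENNReal.ofNat_ne_top fun z hz hzx => h.globalTangentPoint_le hz hzx)
    exact ENNReal.mul_ne_top ENNReal.ofNat_ne_top ENNReal.ofReal_ne_top
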